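/- **Model.** Let $[n]=\{1,\dots,n\}$. A dynamic set stream over $[n]$ is a finite sequence $a_1,\dots,a_t$ of updates $a_i=(S_i,\Delta_i)$ with $S_i\subseteq[n]$ and $\Delta_i\in\{-1,+1\}$, such that at every moment of the stream the multiplicity $\sum_{i:\,S_i=S}\Delta_i$ of every set $S\subseteq[n]$ is non-negative. A set is present at the end if its multiplicity over the whole stream is positive. For an integer $k\ge 0$, let $\mathrm{opt}_k$ be the largest number of elements covered by at most $k$ of the sets present at the end. An $\alpha$-approximate solution is a set $I$ of at most $k$ positions of the stream such that all sets $S_i$, $i\in I$, are present at the end and $\left|\bigcup_{i\in I}S_i\right|\ge \mathrm{opt}_k/\alpha$. A randomized streaming algorithm with $p$ passes and $s$ bits of space has a memory with at most $2^s$ possible contents. The memory is initialised, updated after each update of the stream and at the end of each of $p$ passes over the same stream, each time as a function of the present content, the update just read (if any), and finitely many fresh fair coins; the answer is a function of the final memory content. (Random bits that are to be reused, and counters of passes or updates, have to be kept in the memory; the algorithm may depend on the parameters of the problem.) **Theorem.** There are constants $C>0$ and $d\in\mathbb N$ such that for every $\varepsilon\in(0,1)$ and every $c\in\mathbb N$ there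 is a constant $D=D(\varepsilon,c)>0$ with the following property. For all integers $n\ge1$, $m\ge 2$, $k\ge0$, $T\ge 0$ there is a randomized streaming algorithm that makes at most $C\cdot\frac{\log m}{\varepsilon}$ passes, uses at most $$D\cdot n\cdot(1+\log n+\log m+\log T)^d$$ bits of space (with the convention $\log 0=0$), and that, on every dynamic set stream over $[n]$ of length at most $T$ with at most $m$ distinct sets present at the end, outputs with probability at least $1-(nm)^{-c}$ an $\left(\frac{e}{e-1}+\varepsilon\right)$-approximate solution of the maximum coverage problem with parameter $k$ on the sets present at the end. In particular, for streams of length polynomial in $n$ and $m$ this is a semi-streaming algorithm, i.e. it uses $O(n\cdot\mathrm{poly}\{\log m,\log n\})$ bits of space for every constant $\varepsilon$. -/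

import Mathlib

namespace DynCoverage

/-- One update `(S, Δ)` of a dynamic set stream over the universe `Fin n`; the group `ℤˣ` of units
is `{+1, -1}`: `+1` is an insertion of `S` and `-1` is a deletion of `S`. -/
abbrev SetUpdate (n : ℕ) : Type := Finset (Fin n) × ℤˣ

/-- The multiplicity of `S` after the updates in `F`: the sum of `Δ` over all updates of `S`. -/
def mult {n : ℕ} (F : List (SetUpdate n)) (S : Finset (Fin n)) : ℤ :=
  ((F.filter (fun a => a.1 = S)).map (fun a => (a.2 : ℤ))).sum

/-- Dynamic set streams: at every moment all multiplicities are non-negative. -/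
def IsDynamicStream {n : ℕ} (F : List (SetUpdate n)) : Prop :=
  ∀ G : List (SetUpdate n), G <+: F → ∀ S : Finset (Fin n), 0 ≤ mult G S

/-- The collection of (distinct) sets that are present at the end of the stream. -/
def present {n : ℕ} (F : List (SetUpdate n)) : Finset (Finset (Fin n)) :=
  Finset.univ.filter (fun S => 0 < mult F S)

/-- The number of elements covered by a collection of sets. -/
def coverage {n : ℕ} (𝒞 : Finset (Finset (Fin n))) : ℕ := (𝒞.biUnion id).card

/-- The optimal value of maximum coverage: the largest coverage of at most `k` sets of `𝒮`. -/
def opt {n : ℕ} (𝒮 : Finset (Finset (Fin n))) (k : ℕ) : ℕ :=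
  (𝒮.powerset.filter (fun 𝒞 => 𝒞.card ≤ k)).sup coverage

/-- The sets that are named by a set `I` of positions in the stream. -/
def chosenSets {n : ℕ} (F : List (SetUpdate n)) (I : Finset ℕ) : Finset (Finset (Fin n)) :=
  Finset.univ.filter (fun S => ∃ i ∈ I, (F[i]?).map Prod.fst = some S)

/-- `I` is an `α`-approximate solution of maximum `k`-coverage on the sets present at the end of the
stream `F`: it consists of at most `k` positions of the stream, all the sets at these positions are
present at the end of the stream, and their union has at least `opt / α` elements. -/
def IsApproxSolution {n : ℕ} (F : List (SetUpdate n)) (k : ℕ) (α : ℝ) (I : Finset ℕ) : Prop :=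
  I.card ≤ k ∧ (∀ i ∈ I, i < F.length) ∧ chosenSets F I ⊆ present F ∧
    (opt (present F) k : ℝ) ≤ α * (coverage (chosenSets F I) : ℝ)

/-- A randomized multi-pass streaming algorithm for set streams over `Fin n`. All that it keeps from
one moment to the next is its memory content, an element of the finite type `Mem` (which has to hold
also any counter of passes or updates and any random bits that are used again). In every step it
tosses `coins` fresh fair coins. -/
structure StreamAlg (n : ℕ) where
  /-- possible contents of the memory -/
  Mem : Type
  finite_mem : Finite Mem
  /-- number of passes over the stream -/
  passes : ℕ
  /-- number of coins tossed in each step -/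
  coins : ℕ
  /-- memory content before the first pass -/
  init : (Fin coins → Bool) → Mem
  /-- processing of one update -/
  update : Mem → SetUpdate n → (Fin coins → Bool) → Mem
  /-- computation at the end of a pass -/
  endPass : Mem → (Fin coins → Bool) → Mem
  /-- the answer, read off from the memory after the last pass: positions in the stream -/
  output : Mem → Finset ℕ

namespace StreamAlg

variable {n : ℕ} (A : StreamAlg n)

/-- The space of the algorithm: the number of bits needed to write down a memory content. -/
noncomputable def space : ℕ := Nat.clog 2 (Nat.card A.Mem)

/-- Fresh independent fair coins. -/
noncomputable def toss : PMF (Fin A.coins → Bool) := PMF.uniformOfFintype (Fin A.coins → Bool)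

/-- Effect of one update on the distribution of the memory content. -/
noncomputable def stepDist (μ : PMF A.Mem) (a : SetUpdate n) : PMF A.Mem :=
  μ.bind (fun s => A.toss.map (A.update s a))

/-- Effect of one pass over `F`, including the computation at the end of the pass. -/
noncomputable def passDist (F : List (SetUpdate n)) (μ : PMF A.Mem) : PMF A.Mem :=
  (F.foldl A.stepDist μ).bind (fun s => A.toss.map (A.endPass s))

/-- Distribution of the memory content after all passes over `F`. -/
noncomputable def finalDist (F : List (SetUpdate n)) : PMF A.Mem :=
  (A.passDist F)^[A.passes] (A.toss.map A.init)

/-- Distribution of the answer on the stream `F`. -/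
noncomputable def outputDist (F : List (SetUpdate n)) : PMF (Finset ℕ) :=
  (A.finalDist F).map A.output

/-- The probability that the answer on the stream `F` satisfies `P`. -/
noncomputable def prob (F : List (SetUpdate n)) (P : Finset ℕ → Prop) : ENNReal :=
  (A.outputDist F).toOuterMeasure {I | P I}

end StreamAlg

end DynCoverage

/-! The algorithm is greedy with decreasing thresholds. Fix a guess V with opt ≤ V ≤ 2 opt, put η =
ε/4, and at level i add sets whose gain reaches V/k · (1-η)^i. Once no set reaches the threshold τ,
the optimum exceeds the present coverage by at most kτ (`opt_le_of_gain_le`), so every set added at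
the next level gains at least a (1-η)/k fraction of what is missing (`levels_spec`). After k sets at
most exp(-(1-η)) · opt is missing; if fewer sets are used, O(1/ε) levels bring the deficit below
opt/e (`approximation_of_levels`, `ratio_bound`). All guesses that are powers of two run in
parallel, and the largest cover is returned.

One level takes O(log m) rounds of three passes (`round_spec`, `level_spec`). The first pass keeps
linear sketches modulo a prime, which depend only on final multiplicities: a cell that samples
exactly one heavy present set reveals the key of this set. The second pass checks that the key
belongs to a present set, and the third adds recovered sets greedily. If at least half of the heavy
sets were still heavy at the end of a round with room left, some cell would have isolated one of
them, and the third pass would have added it or found its gain too small. So the number of heavy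
sets at least halves. The cover at the end of a round depends on the sampling pattern, so
`card_not_isolates_le` takes a union bound over all pairs of covers and all thresholds. This costs
about n + log(1/δ) independent patterns, for failure probability δ, and lets the same patterns serve
all rounds and guesses.

Random functions on all subsets of [n] are too large to store. By `exists_seed_table` a fixed table
of polynomially many seeds (in n, T, 1/δ) works for all streams of length at most T at once. The
table is part of the algorithm, and only an index into it is kept in memory. -/

namespace DynCoverage

/-! ### Stored seeds and small tables of seeds -/

section Derandomization

/-- A family of deterministic multi-pass algorithms, one for every outcome of `r` coins that are
tossed in the beginning and kept in memory. -/
def seededAlg {n : ℕ} (r p : ℕ) (M : Type) [Finite M] (start : M)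
    (upd : (Fin r → Bool) → M → SetUpdate n → M) (fin : (Fin r → Bool) → M → M)
    (out : M → Finset ℕ) : StreamAlg n where
  Mem := (Fin r → Bool) × M
  finite_mem := inferInstance
  passes := p
  coins := r
  init b := (b, start)
  update x a _ := (x.1, upd x.1 x.2 a)
  endPass x _ := (x.1, fin x.1 x.2)
  output x := out x.2

/-- A deterministic computation with `p` passes over `F`. -/
def runPasses {M U : Type*} (upd : M → U → M) (fin : M → M) (F : List U) (p : ℕ) (x : M) : M :=
  (fun y => fin (F.foldl upd y))^[p] x

variable {n r p : ℕ} {M : Type} {start : M}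
  {upd : (Fin r → Bool) → M → SetUpdate n → M} {fin : (Fin r → Bool) → M → M}
  {out : M → Finset ℕ}

lemma foldl_map_seeded (F : List (SetUpdate n)) : ∀ μ : PMF ((Fin r → Bool) × M),
    F.foldl (fun μ a => μ.map (fun s => (s.1, upd s.1 s.2 a))) μ =
      μ.map (fun s => (s.1, F.foldl (upd s.1) s.2)) := by
  induction F with
  | nil => intro μ; exact (PMF.map_id μ).symm
  | cons a F ih =>
    intro μ
    rw [List.foldl_cons, ih, PMF.map_comp]
    rfl

variable [Finite M]

/-- The type of the equation is explicit because the memory is this product only after unfolding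
`seededAlg`. Fresh coins are ignored, so they contribute a point mass. -/
lemma seededAlg_stepDist :
    @Eq (PMF ((Fin r → Bool) × M) → SetUpdate n → PMF ((Fin r → Bool) × M))
      (seededAlg r p M start upd fin out).stepDist
      (fun μ a => μ.map (fun s => (s.1, upd s.1 s.2 a))) := by
  funext μ a
  change μ.bind (fun s => (PMF.uniformOfFintype (Fin r → Bool)).map
    (Function.const _ (s.1, upd s.1 s.2 a))) = _
  simp only [PMF.map_const]
  exact PMF.bind_pure_comp _ _

lemma seededAlg_passDist (F : List (SetUpdate n)) :
    @Eq (PMF ((Fin r → Bool) × M) → PMF ((Fin r → Bool) × M))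
      ((seededAlg r p M start upd fin out).passDist F)
      (fun μ => μ.map (fun s => (s.1, fin s.1 (F.foldl (upd s.1) s.2)))) := by
  have h : ∀ S : PMF ((Fin r → Bool) × M) → SetUpdate n → PMF ((Fin r → Bool) × M),
      S = (fun μ a => μ.map (fun s => (s.1, upd s.1 s.2 a))) →
      (fun μ => (F.foldl S μ).bind (fun s => (PMF.uniformOfFintype (Fin r → Bool)).map
        (Function.const _ (s.1, fin s.1 s.2)))) =
      (fun μ => μ.map (fun s => (s.1, fin s.1 (F.foldl (upd s.1) s.2)))) := by
    rintro S rfl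
    funext μ
    rw [foldl_map_seeded]
    simp only [PMF.map_const]
    rw [PMF.bind_map]
    exact PMF.bind_pure_comp _ _
  exact h _ seededAlg_stepDist

lemma seededAlg_finalDist (F : List (SetUpdate n)) :
    @Eq (PMF ((Fin r → Bool) × M)) ((seededAlg r p M start upd fin out).finalDist F)
      ((PMF.uniformOfFintype (Fin r → Bool)).map
        (fun b => (b, runPasses (upd b) (fin b) F p start))) := by
  have h : ∀ (S : PMF ((Fin r → Bool) × M) → PMF ((Fin r → Bool) × M)) (q : ℕ),
      S = (fun μ => μ.map (fun s => (s.1, fin s.1 (F.foldl (upd s.1) s.2)))) →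
      S^[q] ((PMF.uniformOfFintype (Fin r → Bool)).map (fun b => (b, start))) =
      (PMF.uniformOfFintype (Fin r → Bool)).map
        (fun b => (b, runPasses (upd b) (fin b) F q start)) := by
    rintro S q rfl
    induction q with
    | zero => rfl
    | succ q ih =>
      rw [Function.iterate_succ_apply', ih, PMF.map_comp]
      simp only [runPasses, Function.iterate_succ_apply']
      rfl
  exact h _ p (seededAlg_passDist F)

lemma seededAlg_outputDist (F : List (SetUpdate n)) :
    (seededAlg r p M start upd fin out).outputDist F =
    (PMF.uniformOfFintype (Fin r → Bool)).map
      (fun b => out (runPasses (upd b) (fin b) F p start)) := by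
  have h : ∀ μ : PMF ((Fin r → Bool) × M), μ = (PMF.uniformOfFintype (Fin r → Bool)).map
        (fun b => (b, runPasses (upd b) (fin b) F p start)) →
      PMF.map (fun x : (Fin r → Bool) × M => out x.2) μ =
      (PMF.uniformOfFintype (Fin r → Bool)).map
        (fun b => out (runPasses (upd b) (fin b) F p start)) := by
    rintro μ rfl
    rw [PMF.map_comp]
    rfl
  exact h _ (seededAlg_finalDist F)

/-- If at most a `δ`-fraction of the seeds is bad then the algorithm succeeds with probability at
least `1 - δ`. -/
lemma seededAlg_prob_ge (F : List (SetUpdate n)) (P : Finset ℕ → Prop) (δ : ℝ)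
    (bad : Finset (Fin r → Bool)) (hbad : (bad.card : ℝ) ≤ δ * 2 ^ r)
    (hP : ∀ b, b ∉ bad → P (out (runPasses (upd b) (fin b) F p start))) :
    ENNReal.ofReal (1 - δ) ≤ (seededAlg r p M start upd fin out).prob F P := by
  classical
  rw [StreamAlg.prob, seededAlg_outputDist, PMF.toOuterMeasure_map_apply]
  have h1 : (↑(Finset.univ \ bad) : Set (Fin r → Bool)) ⊆
      (fun b => out (runPasses (upd b) (fin b) F p start)) ⁻¹' {I | P I} := by
    intro b hb
    exact hP b (by simpa using hb)
  refine le_trans ?_ (MeasureTheory.measure_mono h1)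
  rw [PMF.toOuterMeasure_uniformOfFintype_apply]
  have h3 : Fintype.card (↑(↑(Finset.univ \ bad) : Set (Fin r → Bool))) = 2 ^ r - bad.card := by
    rw [← Set.toFinset_card, Finset.toFinset_coe,
      Finset.card_sdiff_of_subset (Finset.subset_univ _)]
    simp
  have h4 : bad.card ≤ 2 ^ r := by
    have := Finset.card_le_univ bad
    simpa using this
  rw [h3]
  have h5 : (0 : ℝ) < 2 ^ r := by positivity
  have h6 : ((2 ^ r - bad.card : ℕ) : ENNReal) / (Fintype.card (Fin r → Bool) : ENNReal) =
      ENNReal.ofReal (((2 ^ r - bad.card : ℕ) : ℝ) / 2 ^ r) := by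
    rw [ENNReal.ofReal_div_of_pos h5, ENNReal.ofReal_natCast]
    congr 1
    rw [show (2 : ℝ) ^ r = ((2 ^ r : ℕ) : ℝ) by push_cast; ring, ENNReal.ofReal_natCast]
    simp
  rw [h6]
  apply ENNReal.ofReal_le_ofReal
  rw [le_div_iff₀ h5, Nat.cast_sub h4]
  push_cast
  linarith

lemma seededAlg_card_mem :
    Nat.card (seededAlg r p M start upd fin out).Mem = 2 ^ r * Nat.card M := by
  change Nat.card ((Fin r → Bool) × M) = _
  rw [Nat.card_prod]
  simp

/-- Few samples of a probability space `Ω` suffice to approximate the probabilities of all the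
events in a finite family from above. -/
lemma exists_seed_table {Ω X ι : Type*} [Fintype Ω] [DecidableEq Ω] [Fintype X] [Fintype ι]
    [Nonempty Ω] (bad : X → Finset Ω) (δ : ℝ)
    (hbad : ∀ x, ((bad x).card : ℝ) ≤ δ / 4 * Fintype.card Ω)
    (hι : (Fintype.card X : ℝ) < Real.exp (δ * Fintype.card ι / 4)) :
    ∃ f : ι → Ω, ∀ x,
      ((Finset.univ.filter (fun i => f i ∈ bad x)).card : ℝ) ≤ δ * Fintype.card ι := by
  classical
  by_contra! hcon
  set R := Fintype.card ι
  have hΩ : (0 : ℝ) < Fintype.card Ω := by exact_mod_cast Fintype.card_pos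
  -- Exponential moment of the number of bad samples: the sum factors over the coordinates, and each
  -- factor is at most |Ω|(1 + δ/4).
  have key : ∀ x, ∑ f : ι → Ω, (2 : ℝ) ^ (Finset.univ.filter (fun i => f i ∈ bad x)).card ≤
      (Fintype.card Ω : ℝ) ^ R * Real.exp (δ * R / 4) := by
    intro x
    have e1 : ∀ f : ι → Ω, (2 : ℝ) ^ (Finset.univ.filter (fun i => f i ∈ bad x)).card =
        ∏ i, (if f i ∈ bad x then (2 : ℝ) else 1) := by
      intro f
      rw [Finset.prod_ite]
      simp
    have e2 : ∑ ω : Ω, (if ω ∈ bad x then (2 : ℝ) else 1) =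
        Fintype.card Ω + (bad x).card := by
      have : ∀ ω, (if ω ∈ bad x then (2 : ℝ) else 1) = 1 + if ω ∈ bad x then 1 else 0 := by
        intro ω; split_ifs <;> norm_num
      simp only [this, Finset.sum_add_distrib]
      simp
    simp only [e1]
    have e4 := Finset.prod_univ_sum (fun _ : ι => (Finset.univ : Finset Ω))
      (fun _ ω => if ω ∈ bad x then (2 : ℝ) else 1)
    rw [Fintype.piFinset_univ] at e4
    rw [← e4]
    simp only [e2, Finset.prod_const, Finset.card_univ]
    have e3 : (Fintype.card Ω : ℝ) + (bad x).card ≤ Fintype.card Ω * Real.exp (δ / 4) := by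
      have := Real.add_one_le_exp (δ / 4)
      nlinarith [hbad x]
    calc ((Fintype.card Ω : ℝ) + (bad x).card) ^ R
        ≤ (Fintype.card Ω * Real.exp (δ / 4)) ^ R := by gcongr
      _ = _ := by
        rw [mul_pow, ← Real.exp_nat_mul]
        congr 2; ring
  -- A violated event alone has weight above 2^(δR) ≥ exp(δR/2), as log 2 > 1/2. Summing over all
  -- tables forces |X| ≥ exp(δR/4), contrary to `hι`.
  have lower : ∀ f : ι → Ω, Real.exp (δ * R / 2) ≤
      ∑ x, (2 : ℝ) ^ (Finset.univ.filter (fun i => f i ∈ bad x)).card := by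
    intro f
    obtain ⟨x, hx⟩ := hcon f
    have h1 : Real.exp (δ * R / 2) ≤
        (2 : ℝ) ^ (Finset.univ.filter (fun i => f i ∈ bad x)).card := by
      rw [← Real.exp_log (show (0 : ℝ) <
        2 ^ (Finset.univ.filter (fun i => f i ∈ bad x)).card by positivity), Real.log_pow]
      apply Real.exp_le_exp.2
      have := Real.log_two_gt_d9
      nlinarith
    exact h1.trans (Finset.single_le_sum
      (f := fun x => (2 : ℝ) ^ (Finset.univ.filter (fun i => f i ∈ bad x)).card)
      (fun _ _ => by positivity) (Finset.mem_univ x))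
  have h1 : (Fintype.card Ω : ℝ) ^ R * Real.exp (δ * R / 2) ≤
      Fintype.card X * ((Fintype.card Ω : ℝ) ^ R * Real.exp (δ * R / 4)) := by
    calc (Fintype.card Ω : ℝ) ^ R * Real.exp (δ * R / 2)
        = ∑ f : ι → Ω, Real.exp (δ * R / 2) := by simp [R]
      _ ≤ ∑ f : ι → Ω, ∑ x, (2 : ℝ) ^ (Finset.univ.filter (fun i => f i ∈ bad x)).card :=
        Finset.sum_le_sum (fun f _ => lower f)
      _ = ∑ x, ∑ f : ι → Ω, (2 : ℝ) ^ (Finset.univ.filter (fun i => f i ∈ bad x)).card :=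
        Finset.sum_comm
      _ ≤ ∑ x : X, ((Fintype.card Ω : ℝ) ^ R * Real.exp (δ * R / 4)) :=
        Finset.sum_le_sum (fun x _ => key x)
      _ = _ := by simp
  have h2 : Real.exp (δ * R / 2) = Real.exp (δ * R / 4) * Real.exp (δ * R / 4) := by
    rw [← Real.exp_add]; congr 1; ring
  have h3 : 0 < (Fintype.card Ω : ℝ) ^ R * Real.exp (δ * R / 4) := by positivity
  rw [h2] at h1
  nlinarith

end Derandomization

/-! ### Isolation by sampling, and collisions of random keys -/

section Sampling

/-- The pattern `φ` samples, at rate `q / K`, exactly one element of `A`, and this element belongs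
to `B`. -/
def Isolated {X : Type*} {K : ℕ} (q : ℕ) (A B : Finset X) (φ : X → Fin K) : Prop :=
  ∃ x ∈ B, ∀ y ∈ A, ((φ y : ℕ) < q ↔ y = x)

lemma card_fin_filter_lt {q K : ℕ} (h : q ≤ K) :
    (Finset.univ.filter (fun z : Fin K => (z : ℕ) < q)).card = q := by
  rw [Fin.card_filter_val_lt]
  simpa using h

/-- With rate p = q/K the hypotheses say 1/4 ≤ |A|p ≤ 1/2. The events "only x is sampled", x ∈ B,
are disjoint and have probability p(1-p)^(|A|-1) ≥ p/2, and |B|p ≥ 1/8. -/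
lemma card_isolated_ge {X : Type*} [Fintype X] [DecidableEq X] {q K : ℕ} {A B : Finset X}
    (hBA : B ⊆ A) (hq : 1 ≤ q) (hA : A.Nonempty) (hB : A.card ≤ 2 * B.card)
    (h1 : K ≤ 4 * A.card * q) (h2 : 2 * A.card * q ≤ K)
    [DecidablePred (Isolated (K := K) q A B)] :
    (Fintype.card (X → Fin K) : ℝ) / 16 ≤
      (Finset.univ.filter (Isolated (K := K) q A B)).card := by
  have hA1 : 1 ≤ A.card := hA.card_pos
  have hqK : q ≤ K := by nlinarith
  have hK : 0 < K := by nlinarith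
  -- The patterns that sample x and nothing else from A form a product set, so they are counted
  -- coordinatewise.
  set box : X → Finset (X → Fin K) := fun x => Fintype.piFinset (fun y =>
    if y = x then Finset.univ.filter (fun z : Fin K => (z : ℕ) < q)
    else if y ∈ A then Finset.univ.filter (fun z : Fin K => ¬ (z : ℕ) < q) else Finset.univ)
  have mem_box : ∀ x ∈ A, ∀ φ, φ ∈ box x ↔ ∀ y ∈ A, ((φ y : ℕ) < q ↔ y = x) := by
    intro x hx φ
    simp only [box, Fintype.mem_piFinset]
    refine forall_congr' fun y => ?_
    by_cases hyx : y = x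
    · subst hyx; simp [hx]
    · by_cases hy : y ∈ A <;> simp [hyx, hy]
  have hsub : B.biUnion box ⊆ Finset.univ.filter (Isolated (K := K) q A B) := by
    intro φ hφ
    obtain ⟨x, hx, hφ⟩ := Finset.mem_biUnion.1 hφ
    simp only [Finset.mem_filter, Finset.mem_univ, true_and]
    exact ⟨x, hx, (mem_box x (hBA hx) φ).1 hφ⟩
  have hdisj : ∀ x ∈ B, ∀ y ∈ B, x ≠ y → Disjoint (box x) (box y) := by
    intro x hx y hy hxy
    rw [Finset.disjoint_left]
    intro φ h3 h4
    exact hxy ((((mem_box y (hBA hy) φ).1 h4) x (hBA hx)).1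
      ((((mem_box x (hBA hx) φ).1 h3) x (hBA hx)).2 rfl))
  set p : ℝ := (q : ℝ) / K
  have hK' : (0 : ℝ) < K := by exact_mod_cast hK
  have hcard : ∀ x ∈ B, ((box x).card : ℝ) =
      (K : ℝ) ^ Fintype.card X * (p * (1 - p) ^ (A.card - 1)) := by
    intro x hx
    have hxA := hBA hx
    have c1 : (Finset.univ.filter (fun z : Fin K => ¬ (z : ℕ) < q)).card = K - q := by
      have := Finset.card_filter_add_card_filter_not (s := (Finset.univ : Finset (Fin K)))
        (fun z : Fin K => (z : ℕ) < q)
      rw [card_fin_filter_lt hqK] at this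
      simp only [Finset.card_univ, Fintype.card_fin] at this
      omega
    rw [Fintype.card_piFinset]
    push_cast
    have e : ∀ y, (((if y = x then Finset.univ.filter (fun z : Fin K => (z : ℕ) < q)
        else if y ∈ A then Finset.univ.filter (fun z : Fin K => ¬ (z : ℕ) < q)
        else Finset.univ : Finset (Fin K)).card : ℕ) : ℝ) =
        K * ((if y = x then p else 1) * (if y ∈ A.erase x then 1 - p else 1)) := by
      intro y
      by_cases hyx : y = x
      · simp only [hyx, if_true, card_fin_filter_lt hqK]
        simp [p]; field_simp
      · by_cases hy : y ∈ A
        · simp only [hyx, if_false, hy, if_true, c1]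
          rw [Nat.cast_sub hqK]
          simp [p, hyx, hy]; field_simp
        · simp [hyx, hy]
    simp only [e]
    rw [Finset.prod_mul_distrib, Finset.prod_mul_distrib]
    congr 1
    · simp
    · congr 1
      · simp
      · rw [Finset.prod_ite, Finset.prod_const, Finset.prod_const_one, mul_one,
          Finset.filter_mem_eq_inter, Finset.univ_inter, Finset.card_erase_of_mem hxA]
  have hp0 : 0 < p := by
    have : (0 : ℝ) < q := by exact_mod_cast hq
    positivity
  have hA1' : (1 : ℝ) ≤ A.card := by exact_mod_cast hA1
  have hp2 : 2 * A.card * p ≤ 1 := by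
    have : (2 * A.card * q : ℝ) ≤ K := by exact_mod_cast h2
    simp only [p]
    rw [← mul_div_assoc, div_le_one hK']
    exact this
  have hp4 : 1 ≤ 4 * A.card * p := by
    have : (K : ℝ) ≤ 4 * A.card * q := by exact_mod_cast h1
    simp only [p]
    rw [← mul_div_assoc, one_le_div hK']
    exact this
  have bern : (1 / 2 : ℝ) ≤ (1 - p) ^ (A.card - 1) := by
    have := one_add_mul_le_pow (a := -p) (by nlinarith) (A.card - 1)
    rw [Nat.cast_sub hA1] at this
    rw [sub_eq_add_neg]
    push_cast at this
    nlinarith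
  have hB' : (A.card : ℝ) ≤ 2 * B.card := by exact_mod_cast hB
  calc (Fintype.card (X → Fin K) : ℝ) / 16
      = (K : ℝ) ^ Fintype.card X * (1 / 16) := by simp; ring
    _ ≤ (K : ℝ) ^ Fintype.card X * (B.card * (p * (1 - p) ^ (A.card - 1))) := by
        gcongr
        have : (1 / 8 : ℝ) ≤ B.card * p := by nlinarith
        nlinarith
    _ = ∑ x ∈ B, ((box x).card : ℝ) := by
        rw [Finset.sum_congr rfl hcard]
        simp; ring
    _ = ((B.biUnion box).card : ℝ) := by
        rw [Finset.card_biUnion hdisj]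
        push_cast; rfl
    _ ≤ _ := by exact_mod_cast Finset.card_le_card hsub

lemma card_never_le {Φ : Type*} [Fintype Φ] (s : ℕ) (Q : Φ → Prop) [DecidablePred Q]
    (h : (Fintype.card Φ : ℝ) / 16 ≤ (Finset.univ.filter Q).card) :
    ((Finset.univ.filter (fun σ : Fin s → Φ => ∀ a, ¬ Q (σ a))).card : ℝ) ≤
      (15 / 16) ^ s * Fintype.card (Fin s → Φ) := by
  classical
  have e : Finset.univ.filter (fun σ : Fin s → Φ => ∀ a, ¬ Q (σ a)) =
      Fintype.piFinset (fun _ => Finset.univ.filter (fun φ => ¬ Q φ)) := by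
    ext σ; simp
  have h2 := Finset.card_filter_add_card_filter_not (s := (Finset.univ : Finset Φ)) Q
  rw [Finset.card_univ] at h2
  have h3 : (((Finset.univ.filter Q).card : ℝ) +
    (Finset.univ.filter (fun φ => ¬ Q φ)).card) = Fintype.card Φ := by exact_mod_cast h2
  rw [e, Fintype.card_piFinset]
  simp only [Finset.prod_const, Finset.card_univ, Fintype.card_fin, Fintype.card_pi,
    Nat.cast_pow]
  rw [← mul_pow]
  gcongr
  linarith

/-- Overwriting the value at y is injective on pairs (colliding h, new value), because the lost
value h y can be read off as h x. -/
lemma card_collision_le {X Z : Type*} [Fintype X] [DecidableEq X] [Fintype Z] [DecidableEq Z]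
    {x y : X} (hxy : x ≠ y) :
    (Finset.univ.filter (fun h : X → Z => h x = h y)).card * Fintype.card Z ≤
      Fintype.card (X → Z) := by
  rw [← Finset.card_univ (α := Z), ← Finset.card_product, ← Finset.card_univ (α := X → Z)]
  refine Finset.card_le_card_of_injOn (fun u => Function.update u.1 y u.2) (by simp) ?_
  rintro ⟨f, a⟩ hf ⟨g, b⟩ hg hfg
  simp only [Finset.coe_product, Set.mem_prod, Finset.coe_filter, Set.mem_ofPred_eq,
    Finset.mem_univ, true_and] at hf hg
  simp only at hfg
  have hab : a = b := by simpa using congrFun hfg y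
  have hne : ∀ z, z ≠ y → f z = g z := fun z hz => by simpa [hz] using congrFun hfg z
  refine Prod.ext (funext fun z => ?_) hab
  by_cases hz : z = y
  · subst hz
    exact hf.1.symm.trans ((hne x hxy).trans hg.1)
  · exact hne z hz

lemma card_not_injOn_le {X Z : Type*} [Fintype X] [DecidableEq X] [Fintype Z] [DecidableEq Z]
    [Nonempty Z] (W : Finset X) [DecidablePred (fun h : X → Z => ¬ Set.InjOn h (W : Set X))] :
    ((Finset.univ.filter (fun h : X → Z => ¬ Set.InjOn h (W : Set X))).card : ℝ) ≤
      (W.card : ℝ) ^ 2 / Fintype.card Z * Fintype.card (X → Z) := by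
  have hZ : (0 : ℝ) < Fintype.card Z := by exact_mod_cast Fintype.card_pos
  have hsub : Finset.univ.filter (fun h : X → Z => ¬ Set.InjOn h (W : Set X)) ⊆
      ((W ×ˢ W).filter (fun u => u.1 ≠ u.2)).biUnion
        (fun u => Finset.univ.filter (fun h : X → Z => h u.1 = h u.2)) := by
    intro h hh
    have hh := (Finset.mem_filter.1 hh).2
    simp only [Set.InjOn] at hh
    push Not at hh
    obtain ⟨x, hx, y, hy, hxy, hne⟩ := hh
    simp only [Finset.mem_biUnion, Finset.mem_filter, Finset.mem_product, Finset.mem_univ,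
      true_and]
    exact ⟨(x, y), ⟨⟨hx, hy⟩, hne⟩, hxy⟩
  have h1 := (Finset.card_le_card hsub).trans Finset.card_biUnion_le
  have h2 : ∑ u ∈ (W ×ˢ W).filter (fun u => u.1 ≠ u.2),
      ((Finset.univ.filter (fun h : X → Z => h u.1 = h u.2)).card : ℝ) ≤
      ∑ u ∈ (W ×ˢ W).filter (fun u => u.1 ≠ u.2),
        (Fintype.card (X → Z) : ℝ) / Fintype.card Z := by
    refine Finset.sum_le_sum fun u hu => ?_
    rw [le_div_iff₀ hZ]
    exact_mod_cast card_collision_le (Finset.mem_filter.1 hu).2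
  have h3 : (((W ×ˢ W).filter (fun u => u.1 ≠ u.2)).card : ℝ) ≤ (W.card : ℝ) ^ 2 := by
    have := Finset.card_filter_le (W ×ˢ W) (fun u => u.1 ≠ u.2)
    rw [Finset.card_product] at this
    rw [sq]; exact_mod_cast this
  calc _ ≤ ∑ u ∈ (W ×ˢ W).filter (fun u => u.1 ≠ u.2),
      ((Finset.univ.filter (fun h : X → Z => h u.1 = h u.2)).card : ℝ) := by exact_mod_cast h1
    _ ≤ _ := h2
    _ = (((W ×ˢ W).filter (fun u => u.1 ≠ u.2)).card : ℝ) *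
        (Fintype.card (X → Z) / Fintype.card Z) := by rw [Finset.sum_const, nsmul_eq_mul]
    _ ≤ (W.card : ℝ) ^ 2 * (Fintype.card (X → Z) / Fintype.card Z) := by gcongr
    _ = _ := by ring

end Sampling

/-! ### Partial solutions and greedy steps -/

section Solutions

variable {n T : ℕ}

/-- A partial solution of maximum coverage, stored as the map that assigns to each covered element
the position of the set by which it was covered first. -/
abbrev Cover (n T : ℕ) : Type := Fin n → Option (Fin (T + 1))

/-- The elements that are covered by a partial solution. -/
def covered (w : Cover n T) : Finset (Fin n) := Finset.univ.filter (fun e => w e ≠ none)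

/-- The positions of the sets in a partial solution. -/
def used (w : Cover n T) : Finset (Fin (T + 1)) := Finset.univ.filter (fun i => ∃ e, w e = some i)

/-- Add the set `S` at position `i` to a partial solution. -/
def assign (w : Cover n T) (i : Fin (T + 1)) (S : Finset (Fin n)) : Cover n T :=
  fun e => if w e = none ∧ e ∈ S then some i else w e

/-- The number of elements of `S` outside of `C`. -/
def gain (C S : Finset (Fin n)) : ℕ := (S \ C).card

/-- The sets of the collection `𝒮` with gain at least `t`. -/
def heavy (𝒮 : Finset (Finset (Fin n))) (C : Finset (Fin n)) (t : ℕ) : Finset (Finset (Fin n)) :=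
  𝒮.filter (fun S => t ≤ gain C S)

lemma mem_heavy {𝒮 : Finset (Finset (Fin n))} {C S : Finset (Fin n)} {t : ℕ} :
    S ∈ heavy 𝒮 C t ↔ S ∈ 𝒮 ∧ t ≤ gain C S := Finset.mem_filter

lemma gain_anti {C C' : Finset (Fin n)} (h : C ⊆ C') (S : Finset (Fin n)) :
    gain C' S ≤ gain C S :=
  Finset.card_le_card (Finset.sdiff_subset_sdiff subset_rfl h)

lemma heavy_anti (𝒮 : Finset (Finset (Fin n))) {C C' : Finset (Fin n)} (h : C ⊆ C') (t : ℕ) :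
    heavy 𝒮 C' t ⊆ heavy 𝒮 C t := by
  intro S hS
  rw [mem_heavy] at hS ⊢
  exact ⟨hS.1, hS.2.trans (gain_anti h S)⟩

lemma mem_covered {w : Cover n T} {e : Fin n} : e ∈ covered w ↔ w e ≠ none := by
  simp [covered]

lemma mem_used {w : Cover n T} {i : Fin (T + 1)} : i ∈ used w ↔ ∃ e, w e = some i := by
  simp [used]

lemma covered_assign (w : Cover n T) (i : Fin (T + 1)) (S : Finset (Fin n)) :
    covered (assign w i S) = covered w ∪ S := by
  ext e
  rw [Finset.mem_union, mem_covered, mem_covered]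
  by_cases h1 : w e = none <;> by_cases h2 : e ∈ S <;> simp [assign, h1, h2]

lemma covered_assign_card (w : Cover n T) (i : Fin (T + 1)) (S : Finset (Fin n)) :
    (covered (assign w i S)).card = (covered w).card + gain (covered w) S := by
  rw [covered_assign, gain, ← Finset.union_sdiff_self_eq_union,
    Finset.card_union_of_disjoint Finset.disjoint_sdiff]

lemma used_assign_subset (w : Cover n T) (i : Fin (T + 1)) (S : Finset (Fin n)) :
    used (assign w i S) ⊆ insert i (used w) := by
  intro j hj
  rw [mem_used] at hj
  rw [Finset.mem_insert, mem_used]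
  obtain ⟨e, he⟩ := hj
  simp only [assign] at he
  split_ifs at he with h
  · left; simpa using he.symm
  · right; exact ⟨e, he⟩

lemma used_assign_card_le (w : Cover n T) (i : Fin (T + 1)) (S : Finset (Fin n)) :
    (used (assign w i S)).card ≤ (used w).card + 1 :=
  (Finset.card_le_card (used_assign_subset w i S)).trans (Finset.card_insert_le _ _)

lemma used_subset_used_assign (w : Cover n T) (i : Fin (T + 1)) (S : Finset (Fin n)) :
    used w ⊆ used (assign w i S) := by
  intro j hj
  rw [mem_used] at hj ⊢
  obtain ⟨e, he⟩ := hj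
  exact ⟨e, by simp [assign, he]⟩

/-- One step of the greedy algorithm with threshold `t`. -/
def GreedyStep (F : List (SetUpdate n)) (k t : ℕ) (w w' : Cover n T) : Prop :=
  ∃ (i : Fin (T + 1)) (S : Finset (Fin n)), (F[(i : ℕ)]?).map Prod.fst = some S ∧
    S ∈ present F ∧ t ≤ gain (covered w) S ∧ (used w).card < k ∧ w' = assign w i S

/-- Several steps of the greedy algorithm with threshold `t`. -/
abbrev GreedySteps (F : List (SetUpdate n)) (k t : ℕ) : Cover n T → Cover n T → Prop :=
  Relation.ReflTransGen (GreedyStep F k t)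

lemma GreedySteps.induct {F : List (SetUpdate n)} {k t : ℕ} {w w' : Cover n T}
    (h : GreedySteps F k t w w') (Q : Cover n T → Prop)
    (hQ : ∀ u u', GreedyStep F k t u u' → Q u → Q u') (h0 : Q w) : Q w' := by
  induction h with
  | refl => exact h0
  | tail _ h2 ih => exact hQ _ _ h2 ih

lemma GreedySteps.covered_subset {F : List (SetUpdate n)} {k t : ℕ} {w w' : Cover n T}
    (h : GreedySteps F k t w w') : covered w ⊆ covered w' := by
  refine h.induct (fun u => covered w ⊆ covered u) ?_ subset_rfl
  rintro u u' ⟨i, S, -, -, -, -, rfl⟩ hu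
  rw [covered_assign]
  exact hu.trans Finset.subset_union_left

lemma GreedySteps.used_subset {F : List (SetUpdate n)} {k t : ℕ} {w w' : Cover n T}
    (h : GreedySteps F k t w w') : used w ⊆ used w' := by
  refine h.induct (fun u => used w ⊆ used u) ?_ subset_rfl
  rintro u u' ⟨i, S, -, -, -, -, rfl⟩ hu
  exact hu.trans (used_subset_used_assign _ _ _)

/-- All the sets of the partial solution `w` are present at the end of the stream, and they cover
exactly the elements which `w` records as covered. -/
structure IsSolution (F : List (SetUpdate n)) (k : ℕ) (w : Cover n T) : Prop where
  card_used_le : (used w).card ≤ k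
  spec : ∀ e i, w e = some i → ∃ S, (F[(i : ℕ)]?).map Prod.fst = some S ∧ e ∈ S ∧
    S ∈ present F ∧ S ⊆ covered w

lemma isSolution_none (F : List (SetUpdate n)) (k : ℕ) :
    IsSolution F k (fun _ => none : Cover n T) :=
  ⟨by simp [used], by simp⟩

lemma IsSolution.greedyStep {F : List (SetUpdate n)} {k t : ℕ} {w w' : Cover n T}
    (h : GreedyStep F k t w w') (hw : IsSolution F k w) : IsSolution F k w' := by
  obtain ⟨i, S, hi, hS, -, hk, rfl⟩ := h
  refine ⟨(used_assign_card_le _ _ _).trans hk, fun e j hej => ?_⟩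
  rw [covered_assign]
  simp only [assign] at hej
  split_ifs at hej with h
  · obtain rfl : i = j := by simpa using hej
    exact ⟨S, hi, h.2, hS, Finset.subset_union_right⟩
  · obtain ⟨S', h1, h2, h3, h4⟩ := hw.spec e j hej
    exact ⟨S', h1, h2, h3, h4.trans Finset.subset_union_left⟩

/-- The positions of the sets in a partial solution as natural numbers. -/
def answer (w : Cover n T) : Finset ℕ := (used w).image Fin.val

/-- A position determines its set, so `spec` shows that each chosen set is present and inside
`covered w`. Conversely each covered element lies in the set to whose position it is assigned. -/
lemma IsSolution.isApproxSolution {F : List (SetUpdate n)} {k : ℕ} {α : ℝ} {w : Cover n T}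
    (hw : IsSolution F k w) (hα : (opt (present F) k : ℝ) ≤ α * (covered w).card) :
    IsApproxSolution F k α (answer w) := by
  have hmem : ∀ i ∈ answer w, ∃ S, (F[i]?).map Prod.fst = some S ∧
      S ∈ present F ∧ S ⊆ covered w := by
    intro i hi
    simp only [answer, Finset.mem_image, mem_used] at hi
    obtain ⟨j, ⟨e, he⟩, rfl⟩ := hi
    obtain ⟨S, h1, -, h3, h4⟩ := hw.spec e j he
    exact ⟨S, h1, h3, h4⟩
  refine ⟨Finset.card_image_le.trans hw.card_used_le, fun i hi => ?_, fun S hS => ?_, ?_⟩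
  · obtain ⟨S, h1, -⟩ := hmem i hi
    by_contra hlt
    rw [List.getElem?_eq_none (not_lt.1 hlt)] at h1
    simp at h1
  · simp only [chosenSets, Finset.mem_filter, Finset.mem_univ, true_and] at hS
    obtain ⟨i, hi, hS⟩ := hS
    obtain ⟨S', h1, h2, -⟩ := hmem i hi
    rw [h1] at hS
    exact Option.some_inj.1 hS ▸ h2
  · have : covered w ⊆ (chosenSets F (answer w)).biUnion id := by
      intro e he
      obtain ⟨i, hi⟩ := Option.ne_none_iff_exists'.1 (mem_covered.1 he)
      obtain ⟨S, h1, h2, -⟩ := hw.spec e i hi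
      simp only [Finset.mem_biUnion, chosenSets, Finset.mem_filter, Finset.mem_univ, true_and]
      refine ⟨S, ⟨i, ?_, h1⟩, h2⟩
      simp only [answer, Finset.mem_image, mem_used]
      exact ⟨i, ⟨e, hi⟩, rfl⟩
    refine hα.trans_eq ?_
    congr 2
    refine congrArg _ (Finset.Subset.antisymm this ?_)
    intro e he
    simp only [Finset.mem_biUnion, chosenSets, Finset.mem_filter, Finset.mem_univ,
      true_and, id] at he
    obtain ⟨S, ⟨i, hi, hS⟩, heS⟩ := he
    obtain ⟨S', h1, -, h2⟩ := hmem i hi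
    rw [h1] at hS
    exact h2 (Option.some_inj.1 hS ▸ heS)

end Solutions

/-! ### Linear sketches and multiplicities modulo N -/

section Multiplicities

variable {n : ℕ}

lemma mult_nil (S : Finset (Fin n)) : mult ([] : List (SetUpdate n)) S = 0 := rfl

lemma mult_cons (a : SetUpdate n) (F : List (SetUpdate n)) (S : Finset (Fin n)) :
    mult (a :: F) S = (if a.1 = S then (a.2 : ℤ) else 0) + mult F S := by
  unfold mult
  by_cases h : a.1 = S <;> simp [h]

/-- Linearity of the sketches: insertions and deletions cancel, so only the final multiplicities
matter. -/
lemma sum_updates_eq {R : Type*} [CommRing R] (φ : Finset (Fin n) → R) (F : List (SetUpdate n)) :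
    (F.map (fun a => ((a.2 : ℤ) : R) * φ a.1)).sum = ∑ S, (mult F S : R) * φ S := by
  induction F with
  | nil => simp [mult_nil]
  | cons a F ih =>
    rw [List.map_cons, List.sum_cons, ih]
    simp only [mult_cons, Int.cast_add, add_mul, Finset.sum_add_distrib]
    congr 1
    rw [Finset.sum_eq_single a.1]
    · simp
    · intro S _ hS; simp [hS.symm]
    · simp

lemma mult_le_length (F : List (SetUpdate n)) (S : Finset (Fin n)) : mult F S ≤ F.length := by
  induction F with
  | nil => simp [mult_nil]
  | cons a F ih =>
    rw [mult_cons]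
    have : (if a.1 = S then (a.2 : ℤ) else 0) ≤ 1 := by
      split_ifs
      · rcases Int.units_eq_one_or a.2 with h | h <;> simp [h]
      · norm_num
    push_cast [List.length_cons]
    linarith

/-- The sets that occur in the stream. -/
def occurring (F : List (SetUpdate n)) : Finset (Finset (Fin n)) := (F.map Prod.fst).toFinset

lemma occurring_card_le (F : List (SetUpdate n)) : (occurring F).card ≤ F.length :=
  (List.toFinset_card_le _).trans_eq (List.length_map _)

lemma mem_occurring {F : List (SetUpdate n)} {S : Finset (Fin n)} :
    S ∈ occurring F ↔ ∃ a ∈ F, a.1 = S := by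
  simp [occurring]

lemma mult_eq_zero {F : List (SetUpdate n)} {S : Finset (Fin n)} (h : S ∉ occurring F) :
    mult F S = 0 := by
  have : F.filter (fun a => a.1 = S) = [] := by
    rw [List.filter_eq_nil_iff]
    intro a ha haS
    exact h (mem_occurring.2 ⟨a, ha, by simpa using haS⟩)
  simp [mult, this]

lemma mem_present {F : List (SetUpdate n)} {S : Finset (Fin n)} :
    S ∈ present F ↔ 0 < mult F S := by simp [present]

lemma present_subset_occurring (F : List (SetUpdate n)) : present F ⊆ occurring F := by
  intro S hS
  by_contra h
  rw [mem_present, mult_eq_zero h] at hS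
  exact lt_irrefl _ hS

lemma IsDynamicStream.mult_eq_zero_of_not_mem {F : List (SetUpdate n)} (hF : IsDynamicStream F)
    {S : Finset (Fin n)} (h : S ∉ present F) : mult F S = 0 := by
  rw [mem_present, not_lt] at h
  exact le_antisymm h (hF F (List.prefix_refl F) S)

/-- A positive multiplicity is at most the length of the stream, hence too small to vanish modulo N.
-/
lemma cast_mult_ne_zero {F : List (SetUpdate n)} {N : ℕ} (hN : F.length < N)
    {S : Finset (Fin n)} (h : S ∈ present F) : (mult F S : ZMod N) ≠ 0 := by
  rw [mem_present] at h
  have h2 := mult_le_length F S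
  rw [Ne, ZMod.intCast_zmod_eq_zero_iff_dvd _ N]
  intro hd
  have := Int.le_of_dvd h hd
  omega

end Multiplicities

/-! ### The three-pass rounds of the thresholding algorithm -/

section Machine

/-- Memory content of the thresholding algorithm: the number of the present pass, the position in
the stream, the partial solution, and for each cell a counter, a sum of keys and a check sum. -/
@[ext]
structure State (n T P N : ℕ) (ι : Type) where
  /-- number of the present pass -/
  pass : Fin (P + 1)
  /-- position in the stream -/
  pos : Fin (T + 1)
  /-- partial solution -/
  sol : Cover n T
  /-- total multiplicity of the sets in a cell -/
  count : ι → ZMod N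
  /-- sum of the keys of the sets in a cell, weighted by multiplicities -/
  total : ι → ZMod N
  /-- multiplicity of the set whose key was found in a cell -/
  check : ι → ZMod N

variable {n T P N : ℕ} {ι : Type}

namespace State

/-- The key found in a cell. -/
def candidate (st : State n T P N ι) (c : ι) : ZMod N := st.total c * (st.count c)⁻¹

/-- The set `S` has a key that was found in some cell and belongs to a set that is present. -/
def Verified (key : Finset (Fin n) → ZMod N) (st : State n T P N ι) (S : Finset (Fin n)) : Prop :=
  ∃ c, st.check c ≠ 0 ∧ key S = st.candidate c

/-- The beginning of pass `p` in a round of three passes, with partial solution `w`. -/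
def fresh (p : ℕ) (w : Cover n T) : State n T P N ι :=
  ⟨Fin.ofNat (P + 1) p, 0, w, 0, 0, 0⟩

open Classical in
/-- Processing of one update. Passes come in rounds of three: the first one samples sets whose gain
reaches the threshold, the second one checks which of them are present, and the third one adds
them greedily to the solution. -/
noncomputable def update (key : Finset (Fin n) → ZMod N) (samp : ι → Finset (Fin n) → Prop)
    (k : ℕ) (thr : ℕ → ℕ) (st : State n T P N ι) (a : SetUpdate n) : State n T P N ι :=
  let pos' := Fin.ofNat (T + 1) (st.pos + 1)
  if (st.pass : ℕ) % 3 = 0 then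
    { st with
      pos := pos'
      count := fun c => st.count c + ((a.2 : ℤ) : ZMod N) *
        (if samp c a.1 ∧ thr (st.pass / 3) ≤ gain (covered st.sol) a.1 then 1 else 0)
      total := fun c => st.total c + ((a.2 : ℤ) : ZMod N) *
        (if samp c a.1 ∧ thr (st.pass / 3) ≤ gain (covered st.sol) a.1 then key a.1 else 0) }
  else if (st.pass : ℕ) % 3 = 1 then
    { st with
      pos := pos'
      check := fun c => st.check c + ((a.2 : ℤ) : ZMod N) *
        (if key a.1 = st.candidate c then 1 else 0) }
  else
    { st with
      pos := pos'
      sol := if st.Verified key a.1 ∧ thr (st.pass / 3) ≤ gain (covered st.sol) a.1 ∧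
        (used st.sol).card < k then assign st.sol st.pos a.1 else st.sol }

/-- Computation at the end of a pass. -/
def endPass (st : State n T P N ι) : State n T P N ι :=
  if (st.pass : ℕ) % 3 = 2 then fresh (st.pass + 1) st.sol
  else { st with pass := Fin.ofNat (P + 1) (st.pass + 1), pos := 0 }

variable {key : Finset (Fin n) → ZMod N} {samp : ι → Finset (Fin n) → Prop} {k : ℕ}
  {thr : ℕ → ℕ}

open Classical in
lemma foldl_sample (F : List (SetUpdate n)) : ∀ st : State n T P N ι, (st.pass : ℕ) % 3 = 0 →
    ∃ q, F.foldl (update key samp k thr) st =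
      { st with
        pos := q
        count := fun c => st.count c + ∑ S, (mult F S : ZMod N) *
          (if samp c S ∧ thr (st.pass / 3) ≤ gain (covered st.sol) S then 1 else 0)
        total := fun c => st.total c + ∑ S, (mult F S : ZMod N) *
          (if samp c S ∧ thr (st.pass / 3) ≤ gain (covered st.sol) S then key S else 0) } := by
  simp only [← sum_updates_eq]
  induction F with
  | nil => intro st _; exact ⟨st.pos, by simp⟩
  | cons a F ih =>
    intro st hst
    rw [List.foldl_cons]
    obtain ⟨q, hq⟩ := ih (update key samp k thr st a) (by simp [update, hst])
    refine ⟨q, ?_⟩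
    rw [hq]
    simp [update, hst, add_assoc]

open Classical in
lemma foldl_check (F : List (SetUpdate n)) : ∀ st : State n T P N ι, (st.pass : ℕ) % 3 = 1 →
    ∃ q, F.foldl (update key samp k thr) st =
      { st with
        pos := q
        check := fun c => st.check c + ∑ S, (mult F S : ZMod N) *
          (if key S = st.candidate c then 1 else 0) } := by
  simp only [← sum_updates_eq]
  induction F with
  | nil => intro st _; exact ⟨st.pos, by simp⟩
  | cons a F ih =>
    intro st hst
    rw [List.foldl_cons]
    obtain ⟨q, hq⟩ := ih (update key samp k thr st a) (by simp [update, hst])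
    refine ⟨q, ?_⟩
    have hup : update key samp k thr st a =
        { st with
          pos := Fin.ofNat (T + 1) (st.pos + 1)
          check := fun c => st.check c + ((a.2 : ℤ) : ZMod N) *
            (if key a.1 = st.candidate c then 1 else 0) } := by
      simp only [update, hst, one_ne_zero, if_false, if_true]
    rw [hq, hup]
    simp only [List.map_cons, List.sum_cons, add_assoc, candidate]
    rfl

/-- The induction splits the stream as G ++ H so that the position counter names the set being read.
Verification uses only the sketches, which the third pass leaves unchanged, so `hv` persists. -/
lemma foldl_greedy (F : List (SetUpdate n)) (hT : F.length ≤ T) (t : ℕ) (ht0 : 1 ≤ t) :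
    ∀ (H G : List (SetUpdate n)) (st : State n T P N ι), F = G ++ H → (st.pass : ℕ) % 3 = 2 →
      (st.pos : ℕ) = G.length → thr (st.pass / 3) = t →
      (∀ S ∈ occurring F, st.Verified key S → S ∈ present F) →
    ∃ q w, H.foldl (update key samp k thr) st = { st with pos := q, sol := w } ∧
      GreedySteps F k t st.sol w ∧
      ∀ S ∈ occurring H, st.Verified key S → (used w).card < k → gain (covered w) S < t := by
  classical
  intro H
  induction H with
  | nil =>
    intro G st _ _ _ _ _
    exact ⟨st.pos, st.sol, rfl, Relation.ReflTransGen.refl, by simp [occurring]⟩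
  | cons a H ih =>
    intro G st hF hst hpos ht hv
    have hlen : G.length < T := by
      have : F.length = G.length + (H.length + 1) := by rw [hF]; simp
      omega
    have haF : a ∈ F := by rw [hF]; simp
    set w1 : Cover n T := if st.Verified key a.1 ∧ t ≤ gain (covered st.sol) a.1 ∧
        (used st.sol).card < k then assign st.sol st.pos a.1 else st.sol with hw1
    have hup : update key samp k thr st a =
        { st with pos := Fin.ofNat (T + 1) (st.pos + 1), sol := w1 } := by
      simp [update, hst, ht, hw1]
    have hstep : GreedySteps F k t st.sol w1 := by
      rw [hw1]
      split_ifs with h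
      · refine Relation.ReflTransGen.single ⟨st.pos, a.1, ?_, ?_, h.2.1, h.2.2, rfl⟩
        · rw [hF, hpos]; simp
        · exact hv _ (mem_occurring.2 ⟨a, haF, rfl⟩) h.1
      · exact Relation.ReflTransGen.refl
    obtain ⟨q, w, h1, h2, h3⟩ := ih (G ++ [a])
      { st with pos := Fin.ofNat (T + 1) (st.pos + 1), sol := w1 } (by simp [hF]) hst
      (by simp [hpos]; omega) ht hv
    refine ⟨q, w, ?_, hstep.trans h2, ?_⟩
    · rw [List.foldl_cons, hup, h1]
    · intro S hS hSv hw
      rw [mem_occurring] at hS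
      obtain ⟨b, hb, rfl⟩ := hS
      rcases List.mem_cons.1 hb with rfl | hb
      -- Suppose the set just read has gain at least t in the final cover. By monotonicity it had
      -- such a gain, and there was room, when it was read. So it was added and its final gain is 0
      -- < t.
      · by_contra hge
        have hw1k : (used w1).card < k :=
          (Finset.card_le_card h2.used_subset).trans_lt hw
        have hge1 : t ≤ gain (covered st.sol) b.1 :=
          (not_lt.1 hge).trans (gain_anti (GreedySteps.covered_subset (hstep.trans h2)) b.1)
        have hk0 : (used st.sol).card < k :=
          (Finset.card_le_card hstep.used_subset).trans_lt hw1k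
        have hww : w1 = assign st.sol st.pos b.1 := by
          rw [hw1, if_pos ⟨hSv, hge1, hk0⟩]
        have hsub : b.1 ⊆ covered w := by
          refine subset_trans ?_ h2.covered_subset
          change b.1 ⊆ covered w1
          rw [hww, covered_assign]
          exact Finset.subset_union_right
        rw [gain, Finset.sdiff_eq_empty_iff_subset.2 hsub, Finset.card_empty] at hge
        omega
      · exact h3 _ (mem_occurring.2 ⟨b, hb, rfl⟩) hSv hw

/-- For any two stages of a computation with threshold `t`, if at most half of the sets lose their
gain `t` in between, then some cell samples exactly one of the sets that had gain `t` before, and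
this set has gain `t` afterwards. -/
def Isolates (samp : ι → Finset (Fin n) → Prop) (𝒮 : Finset (Finset (Fin n))) : Prop :=
  ∀ (C C' : Finset (Fin n)) (t : ℕ), C ⊆ C' → (heavy 𝒮 C t).Nonempty →
    (heavy 𝒮 C t).card ≤ 2 * (heavy 𝒮 C' t).card →
    ∃ c, ∃ S₀ ∈ heavy 𝒮 C' t, ∀ S ∈ heavy 𝒮 C t, (samp c S ↔ S = S₀)

/-- One pass. -/
noncomputable def onePass (key : Finset (Fin n) → ZMod N) (samp : ι → Finset (Fin n) → Prop)
    (k : ℕ) (thr : ℕ → ℕ) (F : List (SetUpdate n)) (st : State n T P N ι) : State n T P N ι :=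
  (F.foldl (update key samp k thr) st).endPass

/-- Sound verification makes every addition a legitimate greedy step. Isolation of a set that is
heavy before and after the round is incompatible with the outcome of the third pass, which gives the
halving. -/
lemma round_spec [Fact N.Prime] {F : List (SetUpdate n)} (hF : IsDynamicStream F)
    (hT : F.length ≤ T) (hN : T < N) (hkey : Set.InjOn key (occurring F : Set (Finset (Fin n))))
    (hsamp : Isolates samp (present F)) (j : ℕ) (hj : 3 * j + 3 ≤ P) (hthr : 1 ≤ thr j)
    (w : Cover n T) :
    ∃ w' : Cover n T, (onePass key samp k thr F)^[3] (fresh (3 * j) w : State n T P N ι) =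
        fresh (3 * (j + 1)) w' ∧ GreedySteps F k (thr j) w w' ∧
      ((used w').card < k → heavy (present F) (covered w) (thr j) = ∅ ∨
        2 * (heavy (present F) (covered w') (thr j)).card <
          (heavy (present F) (covered w) (thr j)).card) := by
  classical
  -- The pass counter does not wrap around, since 3j + 3 ≤ P.
  have hp0 : (Fin.ofNat (P + 1) (3 * j) : ℕ) = 3 * j := by
    simp only [Fin.val_ofNat]; exact Nat.mod_eq_of_lt (by omega)
  have hp1 : (Fin.ofNat (P + 1) (3 * j + 1) : ℕ) = 3 * j + 1 := by
    simp only [Fin.val_ofNat]; exact Nat.mod_eq_of_lt (by omega)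
  have hp2 : (Fin.ofNat (P + 1) (3 * j + 2) : ℕ) = 3 * j + 2 := by
    simp only [Fin.val_ofNat]; exact Nat.mod_eq_of_lt (by omega)
  set t := thr j with ht
  set cnt : ι → ZMod N := fun c => ∑ S, (mult F S : ZMod N) *
    (if samp c S ∧ t ≤ gain (covered w) S then 1 else 0) with hcnt
  set tot : ι → ZMod N := fun c => ∑ S, (mult F S : ZMod N) *
    (if samp c S ∧ t ≤ gain (covered w) S then key S else 0) with htot
  set chk : ι → ZMod N := fun c => ∑ S, (mult F S : ZMod N) *
    (if key S = tot c * (cnt c)⁻¹ then 1 else 0) with hchk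
  have e1 : onePass key samp k thr F (fresh (3 * j) w : State n T P N ι) =
      ⟨Fin.ofNat (P + 1) (3 * j + 1), 0, w, cnt, tot, 0⟩ := by
    obtain ⟨q, hq⟩ := foldl_sample (key := key) (samp := samp) (k := k) (thr := thr) F
      (fresh (3 * j) w : State n T P N ι) (by simp only [fresh, hp0]; omega)
    have hdiv : 3 * j / 3 = j := by omega
    rw [onePass, hq]
    simp only [fresh, endPass, hp0, hdiv]
    rw [if_neg (by omega)]
    simp [hcnt, htot, ht]
  have e2 : onePass key samp k thr F
      (⟨Fin.ofNat (P + 1) (3 * j + 1), 0, w, cnt, tot, 0⟩ : State n T P N ι) =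
      ⟨Fin.ofNat (P + 1) (3 * j + 2), 0, w, cnt, tot, chk⟩ := by
    obtain ⟨q, hq⟩ := foldl_check (key := key) (samp := samp) (k := k) (thr := thr) F
      (⟨Fin.ofNat (P + 1) (3 * j + 1), 0, w, cnt, tot, 0⟩ : State n T P N ι)
      (by simp only [hp1]; omega)
    rw [onePass, hq]
    simp only [endPass, hp1]
    rw [if_neg (by omega)]
    simp only [hchk, candidate, Pi.zero_apply, zero_add]
    rfl
  set st2 : State n T P N ι := ⟨Fin.ofNat (P + 1) (3 * j + 2), 0, w, cnt, tot, chk⟩ with hst2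
  -- No false positives: a nonzero check sum has a nonzero summand, which comes from a present set
  -- with the candidate key, and keys are injective on the occurring sets.
  have hver : ∀ S ∈ occurring F, st2.Verified key S → S ∈ present F := by
    rintro S hS ⟨c, hc, hSc⟩
    simp only [hst2, candidate] at hc hSc
    obtain ⟨S', -, hS'⟩ := Finset.exists_ne_zero_of_sum_ne_zero hc
    have h1 : key S' = tot c * (cnt c)⁻¹ := by
      by_contra h; simp [h] at hS'
    have h2 : S' ∈ present F := by
      by_contra h; simp [hF.mult_eq_zero_of_not_mem h] at hS'
    have := hkey (by exact_mod_cast hS) (by exact_mod_cast present_subset_occurring F h2)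
      (hSc.trans h1.symm)
    rwa [this]
  obtain ⟨q, w', h1, h2, h3⟩ := foldl_greedy (samp := samp) (k := k) F hT t hthr F [] st2 rfl
    (by simp only [hst2, hp2]; omega) rfl
    (by simp only [hst2, hp2, ht]; congr 1; omega) hver
  refine ⟨w', ?_, h2, fun hk => ?_⟩
  · rw [Function.iterate_succ_apply, Function.iterate_succ_apply, Function.iterate_succ_apply,
      e1, e2, Function.iterate_zero_apply, onePass, h1]
    simp only [endPass, hst2, hp2]
    rw [if_pos (by omega)]
    rfl
  · by_contra! hcon
    obtain ⟨hne, hhalf⟩ := hcon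
    obtain ⟨c, S₀, hS₀, hiso⟩ := hsamp (covered w) (covered w') t
      (GreedySteps.covered_subset h2) hne hhalf
    have hS₀' := heavy_anti (present F) (GreedySteps.covered_subset h2) t hS₀
    have hpres := (mem_heavy.1 hS₀).1
    have hm0 : (mult F S₀ : ZMod N) ≠ 0 := cast_mult_ne_zero (hT.trans_lt hN) hpres
    -- In cell c every set but S₀ drops out: it is absent with final multiplicity 0, not heavy, or
    -- not sampled. So `cnt c` and `tot c` are single terms with quotient `key S₀`.
    have hz : ∀ S, S ≠ S₀ → (mult F S : ZMod N) = 0 ∨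
        ¬ (samp c S ∧ t ≤ gain (covered w) S) := by
      intro S hS
      by_contra! h
      have hSp : S ∈ present F := by
        by_contra h'; exact h.1 (by simp [hF.mult_eq_zero_of_not_mem h'])
      exact hS ((hiso S (mem_heavy.2 ⟨hSp, h.2.2⟩)).1 h.2.1)
    have hs0 : samp c S₀ ∧ t ≤ gain (covered w) S₀ :=
      ⟨(hiso S₀ hS₀').2 rfl, (mem_heavy.1 hS₀').2⟩
    have hc : cnt c = mult F S₀ := by
      rw [hcnt]
      simp only
      rw [Finset.sum_eq_single S₀]
      · simp [hs0]
      · intro S _ hS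
        rcases hz S hS with h | h <;> simp [h]
      · simp
    have htc : tot c = mult F S₀ * key S₀ := by
      rw [htot]
      simp only
      rw [Finset.sum_eq_single S₀]
      · simp [hs0]
      · intro S _ hS
        rcases hz S hS with h | h <;> simp [h]
      · simp
    have hcand : key S₀ = tot c * (cnt c)⁻¹ := by
      rw [hc, htc]; field_simp
    have hchk0 : chk c ≠ 0 := by
      rw [hchk]
      simp only
      rw [Finset.sum_eq_single S₀]
      · simpa [hcand] using hm0
      · intro S _ hS
        by_cases hSp : S ∈ present F
        · have : key S ≠ tot c * (cnt c)⁻¹ := by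
            rw [← hcand]
            intro h
            exact hS (hkey (by exact_mod_cast present_subset_occurring F hSp)
              (by exact_mod_cast present_subset_occurring F hpres) h)
          simp [this]
        · simp [hF.mult_eq_zero_of_not_mem hSp]
      · simp
    have := h3 S₀ (present_subset_occurring F hpres) ⟨c, hchk0, hcand⟩ hk
    have h4 := (mem_heavy.1 hS₀).2
    omega

end State

end Machine

/-! ### Analysis of greedy with decreasing thresholds -/

section Greedy

variable {n T : ℕ}

lemma exists_opt (𝒮 : Finset (Finset (Fin n))) (k : ℕ) :
    ∃ 𝒞 ⊆ 𝒮, 𝒞.card ≤ k ∧ opt 𝒮 k = coverage 𝒞 := by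
  obtain ⟨𝒞, h1, h2⟩ := Finset.exists_mem_eq_sup
    (𝒮.powerset.filter (fun 𝒞 => 𝒞.card ≤ k)) ⟨∅, by simp⟩ coverage
  rw [Finset.mem_filter, Finset.mem_powerset] at h1
  exact ⟨𝒞, h1.1, h1.2, h2⟩

lemma opt_le_univ (𝒮 : Finset (Finset (Fin n))) (k : ℕ) : opt 𝒮 k ≤ n := by
  obtain ⟨𝒞, -, -, h⟩ := exists_opt 𝒮 k
  rw [h]
  exact (Finset.card_le_univ _).trans_eq (Fintype.card_fin n)

lemma opt_zero (𝒮 : Finset (Finset (Fin n))) : opt 𝒮 0 = 0 := by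
  obtain ⟨𝒞, -, h1, h⟩ := exists_opt 𝒮 0
  rw [h, Finset.card_eq_zero.1 (Nat.le_zero.1 h1)]
  rfl

/-- Each of the at most k optimal sets contributes at most τ elements outside C. -/
lemma opt_le_of_gain_le (𝒮 : Finset (Finset (Fin n))) (k : ℕ) (C : Finset (Fin n)) (τ : ℝ)
    (hτ : 0 ≤ τ) (h : ∀ S ∈ 𝒮, (gain C S : ℝ) ≤ τ) : (opt 𝒮 k : ℝ) ≤ C.card + k * τ := by
  obtain ⟨𝒞, h1, h2, h3⟩ := exists_opt 𝒮 k
  rw [h3, coverage]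
  have e1 : 𝒞.biUnion id ⊆ C ∪ 𝒞.biUnion (fun S => S \ C) := by
    intro x hx
    obtain ⟨S, hS, hxS⟩ := Finset.mem_biUnion.1 hx
    by_cases hxC : x ∈ C
    · exact Finset.mem_union_left _ hxC
    · exact Finset.mem_union_right _ (Finset.mem_biUnion.2 ⟨S, hS, Finset.mem_sdiff.2 ⟨hxS, hxC⟩⟩)
  have e2 : (𝒞.biUnion id).card ≤ C.card + ∑ S ∈ 𝒞, gain C S :=
    (Finset.card_le_card e1).trans ((Finset.card_union_le _ _).trans
      (Nat.add_le_add_left Finset.card_biUnion_le _))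
  have e3 : ∑ S ∈ 𝒞, (gain C S : ℝ) ≤ k * τ := by
    calc ∑ S ∈ 𝒞, (gain C S : ℝ) ≤ ∑ S ∈ 𝒞, τ := Finset.sum_le_sum (fun S hS => h S (h1 hS))
      _ = 𝒞.card * τ := by rw [Finset.sum_const, nsmul_eq_mul]
      _ ≤ k * τ := by gcongr
  have e4 : ((𝒞.biUnion id).card : ℝ) ≤ C.card + ∑ S ∈ 𝒞, (gain C S : ℝ) := by exact_mod_cast e2
  linarith

/-- The uncovered part of the optimum has decreased as it does in the greedy algorithm that selects
sets whose gain is at least `(1 - η)` times the maximum. -/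
def GreedyBound (o : ℕ) (k : ℕ) (η : ℝ) (w : Cover n T) : Prop :=
  (o : ℝ) - (covered w).card ≤ (1 - (1 - η) / k) ^ (used w).card * o

/-- By `ht`, the new set removes at least a (1-η)/k fraction of the deficit. At most one new
position is used, and the base of the power lies in [0,1], so an inequality for `used` suffices. -/
lemma GreedyBound.step {F : List (SetUpdate n)} {o k t : ℕ} {η : ℝ} {w w' : Cover n T}
    (hη : 0 < η) (hη1 : η < 1) (h : GreedyStep F k t w w')
    (hw : GreedyBound o k η w) (ht : (1 - η) * ((o : ℝ) - (covered w).card) ≤ k * t) :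
    GreedyBound o k η w' := by
  obtain ⟨i, S, -, -, hg, hk, rfl⟩ := h
  have hk1 : (1 : ℝ) ≤ k := by exact_mod_cast (by omega : 1 ≤ k)
  have hb1 : (1 - η) / k ≤ 1 := by rw [div_le_one (by linarith)]; linarith
  have hb0 : 0 < (1 - η) / k := by
    have : 0 < 1 - η := by linarith
    positivity
  unfold GreedyBound at hw ⊢
  rw [covered_assign_card]
  have hg' : (t : ℝ) ≤ gain (covered w) S := by exact_mod_cast hg
  have h1 : (1 - η) / k * ((o : ℝ) - (covered w).card) ≤ t := by
    rw [div_mul_eq_mul_div, div_le_iff₀ (by linarith)]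
    linarith
  have h2 : (1 - (1 - η) / k) ^ ((used w).card + 1) * (o : ℝ) ≤
      (1 - (1 - η) / k) ^ (used (assign w i S)).card * o := by
    gcongr ?_ * _
    exact pow_le_pow_of_le_one (by linarith) (by linarith) (used_assign_card_le w i S)
  refine le_trans ?_ h2
  rw [pow_succ]
  push_cast
  calc (o : ℝ) - ((covered w).card + gain (covered w) S)
      ≤ (1 - (1 - η) / k) * (o - (covered w).card) := by linarith
    _ ≤ (1 - (1 - η) / k) * ((1 - (1 - η) / k) ^ (used w).card * o) := by
        gcongr
    _ = _ := by ring

/-- The condition on t survives within a level because the deficit only shrinks. -/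
lemma GreedyBound.steps {F : List (SetUpdate n)} {o k t : ℕ} {η : ℝ} {w w' : Cover n T}
    (hη : 0 < η) (hη1 : η < 1) (h : GreedySteps F k t w w') (hw : GreedyBound o k η w)
    (ht : (used w).card < k → (1 - η) * ((o : ℝ) - (covered w).card) ≤ k * t) :
    GreedyBound o k η w' := by
  refine (GreedySteps.induct h (fun u => GreedyBound o k η u ∧
    ((used u).card < k → (1 - η) * ((o : ℝ) - (covered u).card) ≤ k * t)) ?_ ⟨hw, ht⟩).1
  rintro u u' hu ⟨h1, h2⟩
  have hlt : (used u).card < k := by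
    obtain ⟨_, _, _, _, _, hk, _⟩ := hu
    exact hk
  refine ⟨h1.step hη hη1 hu (h2 hlt), fun _ => ?_⟩
  refine le_trans ?_ (h2 hlt)
  have : (covered u).card ≤ (covered u').card :=
    Finset.card_le_card (GreedySteps.covered_subset (Relation.ReflTransGen.single hu))
  have : ((covered u).card : ℝ) ≤ (covered u').card := by exact_mod_cast this
  have h0 : 0 ≤ 1 - η := by linarith
  gcongr

lemma IsSolution.greedySteps {F : List (SetUpdate n)} {k t : ℕ} {w w' : Cover n T}
    (h : GreedySteps F k t w w') (hw : IsSolution F k w) : IsSolution F k w' :=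
  GreedySteps.induct h _ (fun _ _ hs hu => hu.greedyStep hs) hw

namespace State

variable {P N : ℕ} {ι : Type} {key : Finset (Fin n) → ZMod N} {samp : ι → Finset (Fin n) → Prop}
  {k : ℕ} {thr : ℕ → ℕ}

/-- Each round halves the number of heavy sets, which is at most the number of present sets
initially. With enough rounds it drops below 1. -/
lemma level_spec [Fact N.Prime] {F : List (SetUpdate n)} (hF : IsDynamicStream F)
    (hT : F.length ≤ T) (hN : T < N) (hkey : Set.InjOn key (occurring F : Set (Finset (Fin n))))
    (hsamp : Isolates samp (present F)) (j t : ℕ) (ht : 1 ≤ t) (w : Cover n T) :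
    ∀ q, 3 * (j + q) ≤ P → (∀ i < q, thr (j + i) = t) →
    ∃ w' : Cover n T, (onePass key samp k thr F)^[3 * q] (fresh (3 * j) w : State n T P N ι) =
        fresh (3 * (j + q)) w' ∧ GreedySteps F k t w w' ∧
      ((used w').card < k →
        2 ^ q * (heavy (present F) (covered w') t).card ≤ (present F).card) := by
  intro q
  induction q with
  | zero =>
    intro _ _
    exact ⟨w, rfl, Relation.ReflTransGen.refl,
      fun _ => by
        rw [pow_zero, one_mul]
        exact Finset.card_le_card (Finset.filter_subset _ _)⟩
  | succ q ih =>
    intro hP hthr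
    obtain ⟨w1, h1, h2, h3⟩ := ih (by omega) (fun i hi => hthr i (by omega))
    have htq := hthr q (by omega)
    obtain ⟨w2, h4, h5, h6⟩ := round_spec (k := k) (thr := thr) hF hT hN hkey hsamp (j + q) (P := P)
      (by omega) (by omega) w1
    rw [htq] at h5 h6
    refine ⟨w2, ?_, h2.trans h5, fun hk => ?_⟩
    · rw [show 3 * (q + 1) = 3 + 3 * q by ring, Function.iterate_add_apply, h1, h4]
      rfl
    · have hk1 := (Finset.card_le_card (GreedySteps.used_subset h5)).trans_lt hk
      have h7 := h3 hk1
      have h8 : 2 * (heavy (present F) (covered w2) t).card ≤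
          (heavy (present F) (covered w1) t).card := by
        rcases h6 hk with h | h
        · have := heavy_anti (present F) (GreedySteps.covered_subset h5) t
          rw [h, Finset.subset_empty] at this
          simp [this]
        · exact h.le
      calc 2 ^ (q + 1) * (heavy (present F) (covered w2) t).card
          = 2 ^ q * (2 * (heavy (present F) (covered w2) t).card) := by ring
        _ ≤ 2 ^ q * (heavy (present F) (covered w1) t).card := by gcongr
        _ ≤ _ := h7

/-- The threshold used in round `j`, if there are `q` rounds for every threshold. -/
noncomputable def threshold (V : ℝ) (k : ℕ) (η : ℝ) (q j : ℕ) : ℕ :=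
  ⌈V / k * (1 - η) ^ (j / q)⌉₊

/-- The deficit bound left by one level is what `GreedyBound.steps` needs at the next. Writing I = i
+ 1 makes this bound vacuous before the first level. -/
lemma levels_spec [Fact N.Prime] {F : List (SetUpdate n)} (hF : IsDynamicStream F)
    (hT : F.length ≤ T) (hN : T < N) (hkey : Set.InjOn key (occurring F : Set (Finset (Fin n))))
    (hsamp : Isolates samp (present F)) {q : ℕ} (hq0 : 0 < q) (hq : (present F).card < 2 ^ q) (hk : 1 ≤ k)
    {V η : ℝ} (hV : 0 < V) (hη : 0 < η) (hη1 : η < 1) :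
    ∀ I, 3 * (q * I) ≤ P →
    ∃ w : Cover n T, (onePass key samp k (threshold V k η q) F)^[3 * (q * I)]
        (fresh 0 (fun _ => none) : State n T P N ι) = fresh (3 * (q * I)) w ∧ IsSolution F k w ∧
      (opt (present F) k ≤ V → GreedyBound (opt (present F) k) k η w) ∧
      ((used w).card < k → ∀ i, I = i + 1 →
        (opt (present F) k : ℝ) - (covered w).card ≤ V * (1 - η) ^ i) := by
  have h1η : 0 < 1 - η := by linarith
  have hk' : (0 : ℝ) < k := by exact_mod_cast hk
  intro I
  induction I with
  | zero =>
    intro _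
    refine ⟨_, rfl, isSolution_none F k, fun _ => ?_, fun _ i hi => by omega⟩
    simp [GreedyBound, used]
  | succ I ih =>
    intro hP
    obtain ⟨w, h1, h2, h3, h4⟩ := ih (le_trans (by gcongr; omega) hP)
    set τ : ℝ := V / k * (1 - η) ^ I with hτdef
    have hτ : 0 < τ := by positivity
    obtain ⟨w', h5, h6, h7⟩ := level_spec (P := P) (thr := threshold V k η q) (k := k) hF hT hN
      hkey hsamp (q * I) ⌈τ⌉₊ (Nat.one_le_ceil_iff.2 hτ) w q
      (by rw [← Nat.mul_succ]; exact hP) (by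
        intro i hi
        rw [threshold, Nat.mul_add_div hq0, Nat.div_eq_of_lt hi, add_zero])
    have hτk : (k : ℝ) * τ = V * (1 - η) ^ I := by rw [hτdef]; field_simp
    refine ⟨w', ?_, h2.greedySteps h6, fun hoV => ?_, fun hk i hi => ?_⟩
    · rw [show 3 * (q * (I + 1)) = 3 * q + 3 * (q * I) by ring, Function.iterate_add_apply, h1, h5]
      congr 1; ring
    · refine (h3 hoV).steps hη hη1 h6 fun hlt => ?_
      have hceil : (k : ℝ) * τ ≤ k * (⌈τ⌉₊ : ℝ) := by
        gcongr; exact Nat.le_ceil τ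
      refine le_trans ?_ hceil
      rw [hτk]
      -- At the first level the guess opt ≤ V is used, later the deficit bound of the preceding
      -- level, whose threshold is larger by the factor 1/(1-η).
      rcases I with - | I
      · have : (0 : ℝ) ≤ (covered w).card := by positivity
        rw [pow_zero, mul_one]
        have : 0 ≤ (opt (present F) k : ℝ) := by positivity
        nlinarith
      · have := h4 hlt I rfl
        rw [pow_succ]
        nlinarith
    · obtain rfl : I = i := by omega
      have h8 := h7 hk
      have h9 : (heavy (present F) (covered w') ⌈τ⌉₊).card = 0 := by
        by_contra h
        have : 1 ≤ (heavy (present F) (covered w') ⌈τ⌉₊).card := Nat.one_le_iff_ne_zero.2 h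
        nlinarith
      rw [Finset.card_eq_zero] at h9
      -- Gains are integers, so rounding τ up loses nothing: a gain above τ reaches ⌈τ⌉.
      have := opt_le_of_gain_le (present F) k (covered w') τ hτ.le (by
        intro S hS
        by_contra! hlt
        have : S ∈ heavy (present F) (covered w') ⌈τ⌉₊ :=
          mem_heavy.2 ⟨hS, Nat.ceil_le.2 hlt.le⟩
        rw [h9] at this
        simp at this)
      linarith

/-- If there is room left, the last threshold bounds the deficit by opt/e. Otherwise k steps were
made, and (1 - (1-η)/k)^k ≤ exp(-(1-η)). -/
lemma approximation_of_levels {o k I : ℕ} {V η : ℝ} {w : Cover n T} (hk : 1 ≤ k) (hη : 0 < η)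
    (hη1 : η < 1) (hb : GreedyBound o k η w)
    (hV : V ≤ 2 * o) (hI : 2 * (1 - η) ^ I ≤ Real.exp (-1))
    (h : (used w).card < k → (o : ℝ) - (covered w).card ≤ V * (1 - η) ^ I) :
    (1 - Real.exp (-(1 - η))) * o ≤ (covered w).card := by
  have hk' : (1 : ℝ) ≤ k := by exact_mod_cast hk
  have h1η : 0 < 1 - η := by linarith
  have hb0 : 0 < (1 - η) / k := by positivity
  have hb1 : (1 - η) / k ≤ 1 := by rw [div_le_one (by linarith)]; linarith
  suffices (o : ℝ) - (covered w).card ≤ Real.exp (-(1 - η)) * o by linarith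
  by_cases hu : (used w).card < k
  · refine (h hu).trans ?_
    calc V * (1 - η) ^ I ≤ 2 * o * (1 - η) ^ I := by gcongr
      _ = (2 * (1 - η) ^ I) * o := by ring
      _ ≤ Real.exp (-1) * o := by gcongr
      _ ≤ _ := by gcongr; linarith
  · refine hb.trans ?_
    gcongr
    calc (1 - (1 - η) / k) ^ (used w).card ≤ (1 - (1 - η) / k) ^ k :=
        pow_le_pow_of_le_one (by linarith) (by linarith) (not_lt.1 hu)
      _ ≤ _ := Real.one_sub_div_pow_le_exp_neg (by linarith)

end State

/-- Since exp(ε/4) ≤ 1/(1 - ε/4) ≤ 1 + ε/3, the claim becomes a polynomial inequality in e and ε,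
which holds with slack for e > 2.7. -/
lemma ratio_bound {ε : ℝ} (h0 : 0 < ε) (h1 : ε < 1) :
    1 ≤ (Real.exp 1 / (Real.exp 1 - 1) + ε) * (1 - Real.exp (-(1 - ε / 4))) := by
  have he : 2.7 < Real.exp 1 := by have := Real.exp_one_gt_d9; linarith
  have he2 : Real.exp (-(1 - ε / 4)) * Real.exp 1 = Real.exp (ε / 4) := by
    rw [← Real.exp_add]; congr 1; ring
  have he3 : Real.exp (ε / 4) ≤ 1 + ε / 3 := by
    have := Real.exp_bound_div_one_sub_of_interval (x := ε / 4) (by linarith) (by linarith)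
    refine this.trans ?_
    rw [div_le_iff₀ (by linarith)]
    nlinarith
  set E := Real.exp 1
  set x := Real.exp (-(1 - ε / 4))
  have hx : x * E ≤ 1 + ε / 3 := by linarith
  have hE : 0 < E - 1 := by linarith
  have : (E / (E - 1) + ε) * (1 - x) = (E + ε * (E - 1)) * (E - x * E) / ((E - 1) * E) := by
    field_simp
  rw [this, le_div_iff₀ (by positivity)]
  have h2 : (E + ε * (E - 1)) * (E - 1 - ε / 3) ≤ (E + ε * (E - 1)) * (E - x * E) := by
    have : 0 ≤ E + ε * (E - 1) := by positivity
    exact mul_le_mul_of_nonneg_left (by linarith) this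
  refine le_trans ?_ h2
  nlinarith [mul_pos h0 hE]

end Greedy

/-! ### Probability of a good seed and existence of the table -/

section Seeds

variable {n : ℕ}

/-- Sampling with a random function: cell `(a, j)` samples at rate `2 ^ j / K`. -/
def sampled {s L K : ℕ} (σ : Fin s → Finset (Fin n) → Fin K) (c : Fin s × Fin L)
    (S : Finset (Fin n)) : Prop := (σ c.1 S : ℕ) < 2 ^ (c.2 : ℕ)

lemma gain_le (C S : Finset (Fin n)) : gain C S ≤ n :=
  (Finset.card_le_univ _).trans_eq (Fintype.card_fin n)

/-- The exponent of the sampling rate for collections of `a` sets. -/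
def rateExponent (L a : ℕ) : ℕ := L - 2 - Nat.log 2 a

/-- Among the rates 2^j / 2^L one makes the expected number of samples from a sets lie in [1/4,
1/2], as `card_isolated_ge` requires. -/
lemma rateExponent_spec {L a m : ℕ} (ha : 1 ≤ a) (ham : a ≤ m) (hL : Nat.log 2 m + 2 = L) :
    rateExponent L a < L ∧ 2 ^ L ≤ 4 * a * 2 ^ rateExponent L a ∧
      2 * a * 2 ^ rateExponent L a ≤ 2 ^ L := by
  have h1 : Nat.log 2 a ≤ Nat.log 2 m := Nat.log_mono_right ham
  have h2 : 2 ^ Nat.log 2 a ≤ a := Nat.pow_log_le_self 2 (by omega)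
  have h3 : a < 2 ^ (Nat.log 2 a + 1) := Nat.lt_pow_succ_log_self (by norm_num) a
  have h4 : 2 ^ L = 4 * 2 ^ Nat.log 2 a * 2 ^ rateExponent L a := by
    rw [rateExponent, show (4 : ℕ) = 2 ^ 2 by norm_num, ← pow_add, ← pow_add]
    congr 1; omega
  refine ⟨by unfold rateExponent; omega, ?_, ?_⟩
  · rw [h4]; gcongr
  · rw [h4]
    have : 2 * a ≤ 4 * 2 ^ Nat.log 2 a := by rw [pow_succ] at h3; omega
    gcongr

-- Union bound over C, C' (4^n pairs) and t ≤ n; larger t give no heavy sets. For each triple the s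
-- rows at the suitable rate are independent trials, each failing with probability at most 15/16.
open Classical in
lemma card_not_isolates_le {s L m : ℕ} (hL : Nat.log 2 m + 2 = L)
    (𝒮 : Finset (Finset (Fin n))) (h𝒮 : 𝒮.card ≤ m) :
    ((Finset.univ.filter (fun σ : Fin s → Finset (Fin n) → Fin (2 ^ L) =>
      ¬ State.Isolates (sampled (L := L) σ) 𝒮)).card : ℝ) ≤
    4 ^ n * (n + 1) * (15 / 16) ^ s *
      Fintype.card (Fin s → Finset (Fin n) → Fin (2 ^ L)) := by
  set idx : Finset (Finset (Fin n) × Finset (Fin n) × ℕ) :=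
    (Finset.univ ×ˢ Finset.univ ×ˢ Finset.range (n + 1)).filter
      (fun u => u.1 ⊆ u.2.1 ∧ (heavy 𝒮 u.1 u.2.2).Nonempty ∧
        (heavy 𝒮 u.1 u.2.2).card ≤ 2 * (heavy 𝒮 u.2.1 u.2.2).card) with hidx
  set never : Finset (Fin n) × Finset (Fin n) × ℕ →
      Finset (Fin s → Finset (Fin n) → Fin (2 ^ L)) := fun u =>
    Finset.univ.filter (fun σ => ∀ a, ¬ Isolated
      (2 ^ rateExponent L (heavy 𝒮 u.1 u.2.2).card) (heavy 𝒮 u.1 u.2.2) (heavy 𝒮 u.2.1 u.2.2)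
      (σ a)) with hnever
  have hcard : ∀ C t, (heavy 𝒮 C t).card ≤ m := fun C t =>
    (Finset.card_le_card (Finset.filter_subset _ _)).trans h𝒮
  have hsub : Finset.univ.filter (fun σ : Fin s → Finset (Fin n) → Fin (2 ^ L) =>
      ¬ State.Isolates (sampled (L := L) σ) 𝒮) ⊆ idx.biUnion never := by
    intro σ hσ
    have hσ := (Finset.mem_filter.1 hσ).2
    unfold State.Isolates at hσ
    push Not at hσ
    obtain ⟨C, C', t, h1, h2, h3, h4⟩ := hσ
    refine Finset.mem_biUnion.2 ⟨(C, C', t), ?_, ?_⟩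
    · rw [hidx, Finset.mem_filter]
      refine ⟨?_, h1, h2, h3⟩
      simp only [Finset.mem_product, Finset.mem_univ, Finset.mem_range, true_and]
      obtain ⟨S, hS⟩ := h2
      have := (mem_heavy.1 hS).2
      have := gain_le C S
      omega
    · rw [hnever, Finset.mem_filter]
      refine ⟨Finset.mem_univ _, ?_⟩
      rintro a ⟨S, hS, hSi⟩
      obtain ⟨h5, -⟩ := rateExponent_spec h2.card_pos (hcard C t) hL
      obtain ⟨S', hS', hne⟩ := h4 (a, ⟨_, h5⟩) S hS
      have := hSi S' hS'
      simp only [sampled] at hne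
      tauto
  have hbound : ∀ u ∈ idx, ((never u).card : ℝ) ≤
      (15 / 16) ^ s * Fintype.card (Fin s → Finset (Fin n) → Fin (2 ^ L)) := by
    intro u hu
    rw [hidx, Finset.mem_filter] at hu
    obtain ⟨-, h1, h2, h3⟩ := hu
    obtain ⟨-, h6, h7⟩ := rateExponent_spec h2.card_pos (hcard u.1 u.2.2) hL
    exact card_never_le s _ (card_isolated_ge (heavy_anti 𝒮 h1 _) Nat.one_le_two_pow h2 h3 h6 h7)
  have hidxcard : (idx.card : ℝ) ≤ 4 ^ n * (n + 1) := by
    have : idx.card ≤ 2 ^ n * (2 ^ n * (n + 1)) := by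
      refine (Finset.card_filter_le _ _).trans_eq ?_
      simp [Finset.card_product]
    calc (idx.card : ℝ) ≤ ((2 ^ n * (2 ^ n * (n + 1)) : ℕ) : ℝ) := by exact_mod_cast this
      _ = _ := by
        push_cast
        rw [show (4 : ℝ) = 2 * 2 by norm_num, mul_pow]; ring
  calc _ ≤ ((idx.biUnion never).card : ℝ) := by exact_mod_cast Finset.card_le_card hsub
    _ ≤ ∑ u ∈ idx, ((never u).card : ℝ) := by exact_mod_cast Finset.card_biUnion_le
    _ ≤ ∑ u ∈ idx, (15 / 16) ^ s *
        (Fintype.card (Fin s → Finset (Fin n) → Fin (2 ^ L)) : ℝ) := Finset.sum_le_sum hbound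
    _ = idx.card * ((15 / 16) ^ s *
        (Fintype.card (Fin s → Finset (Fin n) → Fin (2 ^ L)) : ℝ)) := by
        rw [Finset.sum_const, nsmul_eq_mul]
    _ ≤ (4 ^ n * (n + 1)) * ((15 / 16) ^ s *
        (Fintype.card (Fin s → Finset (Fin n) → Fin (2 ^ L)) : ℝ)) := by gcongr
    _ = _ := by ring

/-- The random choices of the algorithm: keys for all sets and a sampling pattern. -/
abbrev Seed (n N s L : ℕ) : Type :=
  (Finset (Fin n) → ZMod N) × (Fin s → Finset (Fin n) → Fin (2 ^ L))

/-- A seed with which the algorithm works for the stream `F`. -/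
def GoodSeed {N s L : ℕ} (F : List (SetUpdate n)) (ω : Seed n N s L) : Prop :=
  Set.InjOn ω.1 (occurring F : Set (Finset (Fin n))) ∧
    State.Isolates (sampled (L := L) ω.2) (present F)

-- Key collisions and failed isolation cost δ/8 each. The total δ/4 is what `exists_seed_table`
-- demands.
open Classical in
lemma card_not_goodSeed_le {N s L m T : ℕ} [NeZero N] (hL : Nat.log 2 m + 2 = L) {δ : ℝ}
    (hs : (4 : ℝ) ^ n * (n + 1) * (15 / 16) ^ s ≤ δ / 8) (hN : (T : ℝ) ^ 2 / N ≤ δ / 8)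
    (F : List (SetUpdate n)) (hT : F.length ≤ T) (hm : (present F).card ≤ m) :
    ((Finset.univ.filter (fun ω : Seed n N s L => ¬ GoodSeed F ω)).card : ℝ) ≤
      δ / 4 * Fintype.card (Seed n N s L) := by
  set X1 := Finset.univ.filter (fun h : Finset (Fin n) → ZMod N =>
    ¬ Set.InjOn h (occurring F : Set (Finset (Fin n))))
  set X2 := Finset.univ.filter (fun σ : Fin s → Finset (Fin n) → Fin (2 ^ L) =>
      ¬ State.Isolates (sampled (L := L) σ) (present F))
  have hsub : Finset.univ.filter (fun ω : Seed n N s L => ¬ GoodSeed F ω) ⊆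
      (X1 ×ˢ Finset.univ) ∪ (Finset.univ ×ˢ X2) := by
    intro ω hω
    have := (Finset.mem_filter.1 hω).2
    rw [GoodSeed, not_and_or] at this
    rcases this with h | h
    · exact Finset.mem_union_left _ (Finset.mem_product.2
        ⟨Finset.mem_filter.2 ⟨Finset.mem_univ _, h⟩, Finset.mem_univ _⟩)
    · exact Finset.mem_union_right _ (Finset.mem_product.2
        ⟨Finset.mem_univ _, Finset.mem_filter.2 ⟨Finset.mem_univ _, h⟩⟩)
  have h1 : (X1.card : ℝ) ≤ δ / 8 * Fintype.card (Finset (Fin n) → ZMod N) := by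
    refine (card_not_injOn_le (occurring F)).trans ?_
    rw [ZMod.card]
    refine mul_le_mul_of_nonneg_right (le_trans ?_ hN) (by positivity)
    have : ((occurring F).card : ℝ) ≤ T := by exact_mod_cast (occurring_card_le F).trans hT
    gcongr
  have h2 : (X2.card : ℝ) ≤ δ / 8 * Fintype.card (Fin s → Finset (Fin n) → Fin (2 ^ L)) := by
    refine (card_not_isolates_le hL (present F) hm).trans ?_
    gcongr
  have h3 := (Finset.card_le_card hsub).trans (Finset.card_union_le _ _)
  rw [Finset.card_product, Finset.card_product, Finset.card_univ, Finset.card_univ] at h3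
  have h4 : ((Finset.univ.filter (fun ω : Seed n N s L => ¬ GoodSeed F ω)).card : ℝ) ≤
      X1.card * Fintype.card (Fin s → Finset (Fin n) → Fin (2 ^ L)) +
      Fintype.card (Finset (Fin n) → ZMod N) * X2.card := by exact_mod_cast h3
  have h5 : (Fintype.card (Seed n N s L) : ℝ) = Fintype.card (Finset (Fin n) → ZMod N) *
      Fintype.card (Fin s → Finset (Fin n) → Fin (2 ^ L)) := by
    rw [← Nat.cast_mul, ← Fintype.card_prod]
  rw [h5]
  refine h4.trans ?_
  set a : ℝ := ((Fintype.card (Finset (Fin n) → ZMod N) : ℕ) : ℝ)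
  set b : ℝ := ((Fintype.card (Fin s → Finset (Fin n) → Fin (2 ^ L)) : ℕ) : ℝ)
  have ha : 0 ≤ a := by positivity
  have hb : 0 ≤ b := by positivity
  nlinarith [mul_le_mul_of_nonneg_right h1 hb, mul_le_mul_of_nonneg_left h2 ha]

/-- Every list of length at most `T` is a prefix of the list of values of a function. -/
lemma exists_take_ofFn {U : Type*} [Inhabited U] (T : ℕ) (F : List U) (hT : F.length ≤ T) :
    ∃ (l : Fin (T + 1)) (x : Fin T → U), (List.ofFn x).take l = F := by
  refine ⟨⟨F.length, by omega⟩, fun i => F.getD i default, ?_⟩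
  apply List.ext_getElem
  · simp [hT]
  · intro i h1 h2
    simp [List.getElem?_eq_getElem h2]

/-- There are at most (T+1) · 2^((n+1)T) < exp(δ 2^r / 4) streams to handle. They are coded as
truncated functions to get a finite type; streams with more than m present sets receive an empty bad
event. -/
lemma exists_good_seed_table {N s L m T r : ℕ} [NeZero N] (hL : Nat.log 2 m + 2 = L)
    {δ : ℝ} (hs : (4 : ℝ) ^ n * (n + 1) * (15 / 16) ^ s ≤ δ / 8)
    (hN : (T : ℝ) ^ 2 / N ≤ δ / 8) (hr : 4 * ((n : ℝ) + 2) * (T + 1) ≤ δ * 2 ^ r) :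
    ∃ f : (Fin r → Bool) → Seed n N s L, ∀ F : List (SetUpdate n), F.length ≤ T →
      (present F).card ≤ m →
      ∃ bad : Finset (Fin r → Bool), (bad.card : ℝ) ≤ δ * 2 ^ r ∧
        ∀ b, b ∉ bad → GoodSeed F (f b) := by
  classical
  set dec : Fin (T + 1) × (Fin T → SetUpdate n) → List (SetUpdate n) :=
    fun u => (List.ofFn u.2).take u.1 with hdec
  have hδ : 0 ≤ δ := by
    have : (0 : ℝ) ≤ (T : ℝ) ^ 2 / N := by positivity
    linarith
  obtain ⟨f, hf⟩ := exists_seed_table (ι := Fin r → Bool) (fun u => if (present (dec u)).card ≤ m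
      then Finset.univ.filter (fun ω : Seed n N s L => ¬ GoodSeed (dec u) ω) else ∅) δ (by
      intro u
      split_ifs with h
      · refine card_not_goodSeed_le (T := T) hL hs hN (dec u) ?_ h
        simp [hdec]
      · simp only [Finset.card_empty, Nat.cast_zero]
        positivity) (by
      have h1 : (Fintype.card (Fin (T + 1) × (Fin T → SetUpdate n)) : ℝ) =
          (T + 1) * (2 ^ n * 2) ^ T := by
        simp [Fintype.card_prod]
      have h2 : (Fintype.card (Fin r → Bool) : ℝ) = 2 ^ r := by simp
      rw [h1, h2]
      have h3 : (T : ℝ) + 1 ≤ Real.exp T := Real.add_one_le_exp _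
      have h4 : (2 : ℝ) ≤ Real.exp 1 := by have := Real.exp_one_gt_d9; linarith
      calc ((T : ℝ) + 1) * (2 ^ n * 2) ^ T ≤ Real.exp T * (Real.exp 1 ^ n * Real.exp 1) ^ T := by
            gcongr
        _ = Real.exp (T * (n + 2)) := by
            rw [← pow_succ, ← Real.exp_nat_mul, ← Real.exp_nat_mul, ← Real.exp_add]
            congr 1; push_cast; ring
        _ < _ := by
            apply Real.exp_lt_exp.2
            have : (0 : ℝ) ≤ n := by positivity
            nlinarith)
  refine ⟨f, fun F hT hm => ?_⟩
  obtain ⟨l, x, hx⟩ := exists_take_ofFn T F hT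
  have h := hf (l, x)
  have hF : dec (l, x) = F := hx
  simp only [hF, hm, if_true] at h
  refine ⟨_, h.trans_eq (by simp), fun b hb => ?_⟩
  by_contra hg
  exact hb (by simp [hg])

end Seeds

/-! ### The parallel algorithm: correctness and memory size -/

section Space

namespace State

variable {n T P N : ℕ} {ι : Type}

/-- A memory content as a tuple. -/
def toTuple (st : State n T P N ι) : Fin (P + 1) × Fin (T + 1) × Cover n T × (ι → ZMod N) ×
    (ι → ZMod N) × (ι → ZMod N) :=
  (st.pass, st.pos, st.sol, st.count, st.total, st.check)

lemma toTuple_injective : Function.Injective (toTuple : State n T P N ι → _) := by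
  intro a b h
  simp only [toTuple, Prod.mk.injEq] at h
  obtain ⟨h1, h2, h3, h4, h5, h6⟩ := h
  exact State.ext h1 h2 h3 h4 h5 h6

instance [Finite ι] [NeZero N] : Finite (State n T P N ι) :=
  Finite.of_injective _ toTuple_injective

lemma card_le [Fintype ι] [NeZero N] : Nat.card (State n T P N ι) ≤
    (P + 1) * ((T + 1) * ((T + 2) ^ n * N ^ (3 * Fintype.card ι))) := by
  classical
  refine (Nat.card_le_card_of_injective _ toTuple_injective).trans_eq ?_
  simp only [Nat.card_eq_fintype_card, Fintype.card_prod, Fintype.card_fin, Fintype.card_pi,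
    Fintype.card_option, Finset.prod_const, Finset.card_univ, ZMod.card]
  ring

end State

/-- The algorithm that runs the thresholding algorithm in parallel for the guesses
`1, 2, 4, ..., 2 ^ G` of the optimal value. -/
noncomputable def coverageAlg {n : ℕ} (k T P N s L G q r : ℕ) [NeZero N] (η : ℝ)
    (f : (Fin r → Bool) → Seed n N s L) : StreamAlg n :=
  seededAlg r P (Fin (G + 1) → State n T P N (Fin s × Fin L))
    (fun _ => State.fresh 0 (fun _ => none))
    (fun b x a g => State.update (f b).1 (sampled (f b).2) k
      (State.threshold (2 ^ (g : ℕ)) k η q) (x g) a)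
    (fun _ x g => (x g).endPass)
    (fun x => answer (x (Finite.exists_max (fun g => (covered (x g).sol).card)).choose).sol)

lemma foldl_pi {ι M U : Type*} (upd : ι → M → U → M) (F : List U) : ∀ (x : ι → M) (g : ι),
    F.foldl (fun x a g => upd g (x g) a) x g = F.foldl (upd g) (x g) := by
  induction F with
  | nil => intro x g; rfl
  | cons a F ih => intro x g; exact ih _ g

lemma runPasses_pi {ι M U : Type*} (upd : ι → M → U → M) (fin : M → M) (F : List U) (p : ℕ)
    (x : ι → M) (g : ι) :
    runPasses (fun x a g => upd g (x g) a) (fun x g => fin (x g)) F p x g =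
      runPasses (upd g) fin F p (x g) := by
  induction p with
  | zero => rfl
  | succ p ih =>
    simp only [runPasses, Function.iterate_succ_apply', foldl_pi] at ih ⊢
    rw [ih]

lemma exists_guess {o n : ℕ} (ho : 1 ≤ o) (hn : o ≤ n) :
    ∃ g ≤ Nat.clog 2 n, o ≤ 2 ^ g ∧ 2 ^ g ≤ 2 * o := by
  refine ⟨Nat.clog 2 o, Nat.clog_mono_right 2 hn, Nat.le_pow_clog (by norm_num) o, ?_⟩
  rcases ho.eq_or_lt with rfl | h
  · simp
  · have h1 := Nat.pow_pred_clog_lt_self (b := 2) (by norm_num) h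
    have h2 := Nat.clog_pos (b := 2) (by norm_num) h
    calc 2 ^ Nat.clog 2 o = 2 * 2 ^ (Nat.clog 2 o).pred := by
          rw [← pow_succ']; congr 1; simp; omega
      _ ≤ _ := by gcongr

/-- Every guess, right or wrong, yields a valid solution. Hence the largest cover is valid and at
least as good as the one for the right guess. -/
lemma coverageAlg_prob_ge {n k T N s L q r m I : ℕ} [Fact N.Prime] {ε δ : ℝ} (hk : 1 ≤ k)
    (hε : 0 < ε) (hε1 : ε < 1) (hN : T < N) (hq0 : 0 < q) (hq : m < 2 ^ q)
    (hI : 2 * (1 - ε / 4) ^ I ≤ Real.exp (-1)) (f : (Fin r → Bool) → Seed n N s L)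
    {F : List (SetUpdate n)} (hF : IsDynamicStream F) (hT : F.length ≤ T)
    (hm : (present F).card ≤ m) {bad : Finset (Fin r → Bool)}
    (hbad : (bad.card : ℝ) ≤ δ * 2 ^ r) (hf : ∀ b, b ∉ bad → GoodSeed F (f b)) :
    ENNReal.ofReal (1 - δ) ≤
      (coverageAlg k T (3 * (q * (I + 1))) N s L (Nat.clog 2 n) q r (ε / 4) f).prob F
        (IsApproxSolution F k (Real.exp 1 / (Real.exp 1 - 1) + ε)) := by
  refine seededAlg_prob_ge F _ δ bad hbad fun b hb => ?_
  obtain ⟨hkey, hsamp⟩ := hf b hb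
  set x := runPasses (fun (x : Fin (Nat.clog 2 n + 1) →
      State n T (3 * (q * (I + 1))) N (Fin s × Fin L)) a g =>
    State.update (f b).1 (sampled (f b).2) k (State.threshold (2 ^ (g : ℕ)) k (ε / 4) q) (x g) a)
    (fun x g => (x g).endPass) F (3 * (q * (I + 1)))
    (fun _ => State.fresh 0 (fun _ => none)) with hx
  have hrun : ∀ g, IsSolution F k (x g).sol ∧ (opt (present F) k ≤ (2 : ℝ) ^ (g : ℕ) →
      (2 : ℝ) ^ (g : ℕ) ≤ 2 * opt (present F) k →
      (1 - Real.exp (-(1 - ε / 4))) * opt (present F) k ≤ (covered (x g).sol).card) := by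
    intro g
    obtain ⟨w, h1, h2, h3, h4⟩ := State.levels_spec (P := 3 * (q * (I + 1))) hF hT hN hkey hsamp
      hq0 (hm.trans_lt hq) hk (V := (2 : ℝ) ^ (g : ℕ)) (by positivity)
      (η := ε / 4) (by linarith) (by linarith) (I + 1) le_rfl
    have hxg : (x g).sol = w := by
      rw [hx, runPasses_pi (fun g : Fin (Nat.clog 2 n + 1) =>
        State.update (f b).1 (sampled (f b).2) k (State.threshold (2 ^ (g : ℕ)) k (ε / 4) q))]
      exact congrArg State.sol h1
    rw [hxg]
    exact ⟨h2, fun h5 h6 => State.approximation_of_levels hk (by linarith) (by linarith)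
      (h3 h5) h6 hI (fun hu => h4 hu I rfl)⟩
  set best := (Finite.exists_max (fun g => (covered (x g).sol).card)).choose
  have hbest : ∀ g, (covered (x g).sol).card ≤ (covered (x best).sol).card :=
    (Finite.exists_max (fun g => (covered (x g).sol).card)).choose_spec
  refine (hrun best).1.isApproxSolution ?_
  have he : 1 < Real.exp 1 := Real.one_lt_exp_iff.2 one_pos
  have hα : 0 ≤ Real.exp 1 / (Real.exp 1 - 1) + ε := by
    have : 0 < Real.exp 1 - 1 := by linarith
    positivity
  rcases Nat.eq_zero_or_pos (opt (present F) k) with ho | ho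
  · rw [ho, Nat.cast_zero]; positivity
  obtain ⟨g, hg, h1, h2⟩ := exists_guess ho (opt_le_univ _ _)
  have h3 := (hrun ⟨g, by omega⟩).2 (by exact_mod_cast h1) (by exact_mod_cast h2)
  have h4 : ((covered (x ⟨g, by omega⟩).sol).card : ℝ) ≤ (covered (x best).sol).card := by
    exact_mod_cast hbest _
  have h5 := ratio_bound hε hε1
  calc (opt (present F) k : ℝ)
      ≤ ((Real.exp 1 / (Real.exp 1 - 1) + ε) * (1 - Real.exp (-(1 - ε / 4)))) *
        opt (present F) k := le_mul_of_one_le_left (by positivity) h5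
    _ = (Real.exp 1 / (Real.exp 1 - 1) + ε) * ((1 - Real.exp (-(1 - ε / 4))) *
        opt (present F) k) := by ring
    _ ≤ _ := mul_le_mul_of_nonneg_left (h3.trans h4) hα

lemma clog_le_log {x : ℕ} (hx : 1 ≤ x) : (Nat.clog 2 x : ℝ) ≤ 2 * Real.log x + 1 := by
  rcases hx.eq_or_lt with rfl | h
  · simp
  have h1 := Nat.pow_pred_clog_lt_self (b := 2) (by norm_num) h
  have h2 := Nat.clog_pos (b := 2) (by norm_num) h
  have h3 : ((2 : ℝ) ^ (Nat.clog 2 x).pred) ≤ x := by exact_mod_cast h1.le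
  have h4 := Real.log_le_log (by positivity) h3
  rw [Real.log_pow] at h4
  have h5 : (((Nat.clog 2 x).pred : ℕ) : ℝ) = Nat.clog 2 x - 1 := by
    rw [Nat.pred_eq_sub_one, Nat.cast_sub h2]; simp
  rw [h5] at h4
  have h6 := Real.log_two_gt_d9
  have h7 : (0 : ℝ) ≤ (Nat.clog 2 x : ℝ) - 1 := by
    have : (1 : ℝ) ≤ Nat.clog 2 x := by exact_mod_cast h2
    linarith
  nlinarith

lemma log_le_log {x : ℕ} (hx : 1 ≤ x) : (Nat.log 2 x : ℝ) ≤ 3 / 2 * Real.log x := by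
  have h1 := Nat.pow_log_le_self 2 (show x ≠ 0 by omega)
  have h3 : ((2 : ℝ) ^ Nat.log 2 x) ≤ x := by exact_mod_cast h1
  have h4 := Real.log_le_log (by positivity) h3
  rw [Real.log_pow] at h4
  have h6 := Real.log_two_gt_d9
  have h7 : (0 : ℝ) ≤ (Nat.log 2 x : ℝ) := by positivity
  nlinarith

/-- An upper bound for the space of the algorithm. -/
lemma coverageAlg_space_le {n k T P N s L G q r : ℕ} [NeZero N] {η : ℝ}
    (f : (Fin r → Bool) → Seed n N s L) :
    ((coverageAlg k T P N s L G q r η f).space : ℝ) ≤ 2 * (r + (G + 1) * (Real.log (P + 1) +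
      Real.log (T + 1) + n * Real.log (T + 2) + 3 * s * L * Real.log N)) + 1 := by
  have hN : 0 < N := Nat.pos_of_ne_zero (NeZero.ne N)
  have h1 : Nat.card (coverageAlg k T P N s L G q r η f).Mem ≤
      2 ^ r * ((P + 1) * ((T + 1) * ((T + 2) ^ n * N ^ (3 * (s * L))))) ^ (G + 1) := by
    rw [coverageAlg, seededAlg_card_mem, Nat.card_fun]
    have := State.card_le (n := n) (T := T) (P := P) (N := N) (ι := Fin s × Fin L)
    rw [Fintype.card_prod, Fintype.card_fin, Fintype.card_fin] at this
    simp only [Nat.card_eq_fintype_card (α := Fin (G + 1)), Fintype.card_fin]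
    gcongr
  rw [StreamAlg.space]
  refine (Nat.cast_le.2 (Nat.clog_mono_right 2 h1)).trans ?_
  refine (clog_le_log (Nat.one_le_iff_ne_zero.2 (by positivity))).trans ?_
  have hlog2 : Real.log 2 ≤ 1 := by have := Real.log_two_lt_d9; linarith
  have hN' : (N : ℝ) ≠ 0 := by positivity
  have e : Real.log ((2 ^ r * ((P + 1) * ((T + 1) * ((T + 2) ^ n * N ^ (3 * (s * L))))) ^ (G + 1)
      : ℕ) : ℝ) = r * Real.log 2 + (G + 1) * (Real.log (P + 1) +
      (Real.log (T + 1) + (n * Real.log (T + 2) + 3 * (s * L) * Real.log N))) := by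
    push_cast
    have a1 : (P : ℝ) + 1 ≠ 0 := by positivity
    have a2 : (T : ℝ) + 1 ≠ 0 := by positivity
    have a3 : (T : ℝ) + 2 ≠ 0 := by positivity
    rw [Real.log_mul (by positivity) (by positivity), Real.log_pow, Real.log_pow,
      Real.log_mul a1 (by positivity), Real.log_mul a2 (by positivity),
      Real.log_mul (by positivity) (by positivity), Real.log_pow, Real.log_pow]
    push_cast
    ring
  rw [e]
  have : (r : ℝ) * Real.log 2 ≤ r := mul_le_of_le_one_right (by positivity) hlog2
  linarith

end Space

/-! ### Numerical estimates and choice of parameters -/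

section Parameters

lemma log_add_two_le (T : ℕ) : Real.log ((T : ℝ) + 2) ≤ 2 + Real.log T := by
  have h2 : Real.log 2 ≤ 1 := by have := Real.log_two_lt_d9; linarith
  rcases Nat.eq_zero_or_pos T with rfl | h
  · simp; linarith
  have hT : (1 : ℝ) ≤ T := by exact_mod_cast h
  calc Real.log ((T : ℝ) + 2) ≤ Real.log (2 * 2 * T) :=
        Real.log_le_log (by positivity) (by linarith)
    _ = Real.log 2 + Real.log 2 + Real.log T := by
        rw [Real.log_mul (by norm_num) (by positivity), Real.log_mul (by norm_num) (by norm_num)]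
    _ ≤ _ := by linarith

lemma log_add_one_le (T : ℕ) : Real.log ((T : ℝ) + 1) ≤ 2 + Real.log T :=
  (Real.log_le_log (by positivity) (by linarith)).trans (log_add_two_le T)

/-- The power is at most exp(-(ε/4)(8/ε)) = exp(-2), and 2 ≤ e. -/
lemma two_mul_pow_ceil_le {ε : ℝ} (hε : 0 < ε) (hε1 : ε < 1) :
    2 * (1 - ε / 4) ^ ⌈8 / ε⌉₊ ≤ Real.exp (-1) := by
  have h1 : 1 - ε / 4 ≤ Real.exp (-(ε / 4)) := Real.one_sub_le_exp_neg _
  have h2 : 8 / ε ≤ ⌈8 / ε⌉₊ := Nat.le_ceil _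
  have h3 : (1 - ε / 4) ^ ⌈8 / ε⌉₊ ≤ Real.exp (-2) := by
    calc (1 - ε / 4) ^ ⌈8 / ε⌉₊ ≤ Real.exp (-(ε / 4)) ^ ⌈8 / ε⌉₊ :=
          pow_le_pow_left₀ (by linarith) h1 _
      _ = Real.exp (⌈8 / ε⌉₊ * -(ε / 4)) := by rw [← Real.exp_nat_mul]
      _ ≤ _ := by
        apply Real.exp_le_exp.2
        rw [div_le_iff₀ hε] at h2
        linarith
  have h4 : (2 : ℝ) ≤ Real.exp 1 := by have := Real.exp_one_gt_d9; linarith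
  calc 2 * (1 - ε / 4) ^ ⌈8 / ε⌉₊ ≤ Real.exp 1 * Real.exp (-2) := by
        have : 0 ≤ (1 - ε / 4) ^ ⌈8 / ε⌉₊ := pow_nonneg (by linarith) _
        gcongr
    _ = _ := by rw [← Real.exp_add]; norm_num

lemma passes_le {ε : ℝ} (hε : 0 < ε) (hε1 : ε < 1) {m : ℕ} (hm : 2 ≤ m) :
    ((3 * ((Nat.log 2 m + 1) * (⌈8 / ε⌉₊ + 1)) : ℕ) : ℝ) ≤ 90 * (Real.log m / ε) := by
  have hm' : (2 : ℝ) ≤ m := by exact_mod_cast hm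
  have h1 := log_le_log (show 1 ≤ m by omega)
  have h2 : Real.log 2 ≤ Real.log m := Real.log_le_log (by norm_num) hm'
  have h3 := Real.log_two_gt_d9
  have h4 : (⌈8 / ε⌉₊ : ℝ) < 8 / ε + 1 := Nat.ceil_lt_add_one (by positivity)
  have h5 : 1 ≤ 1 / ε := by rw [one_le_div hε]; exact hε1.le
  have h6 : 8 / ε = 8 * (1 / ε) := by ring
  have h7 : (Nat.log 2 m : ℝ) + 1 ≤ 3 * Real.log m := by linarith
  have h8 : (⌈8 / ε⌉₊ : ℝ) + 1 ≤ 10 * (1 / ε) := by linarith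
  push_cast
  calc (3 : ℝ) * ((Nat.log 2 m + 1) * (⌈8 / ε⌉₊ + 1))
      ≤ 3 * ((3 * Real.log m) * (10 * (1 / ε))) := by
        gcongr
    _ = _ := by ring

/-- Here 4^n (n+1) · 8 ≤ 8^(n+1) ≤ exp(3(n+1)), while (15/16)^s ≤ exp(-s/16). -/
lemma union_bound_le {s : ℕ} {n : ℕ} {y : ℝ} (hs : 16 * (3 * ((n : ℝ) + 1) + y) ≤ s) :
    (4 : ℝ) ^ n * (n + 1) * (15 / 16) ^ s ≤ Real.exp (-y) / 8 := by
  have h1 : (15 / 16 : ℝ) ^ s ≤ Real.exp (-(3 * (n + 1) + y)) := by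
    calc (15 / 16 : ℝ) ^ s ≤ Real.exp (-(1 / 16)) ^ s := by
          gcongr
          have := Real.one_sub_le_exp_neg (1 / 16)
          linarith
      _ = Real.exp (s * (-(1 / 16))) := by rw [← Real.exp_nat_mul]
      _ ≤ _ := Real.exp_le_exp.2 (by linarith)
  have h2 : (2 : ℝ) ≤ Real.exp 1 := by have := Real.exp_one_gt_d9; linarith
  have h8 : (8 : ℝ) ≤ Real.exp 3 := by
    calc (8 : ℝ) = 2 ^ 3 := by norm_num
      _ ≤ Real.exp 1 ^ 3 := by gcongr
      _ = Real.exp 3 := by rw [← Real.exp_nat_mul]; norm_num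
  have h4 : (4 : ℝ) ^ n * (n + 1) ≤ 8 ^ n := by
    have h : (n : ℝ) + 1 ≤ 2 ^ n := by
      have := Nat.lt_two_pow_self (n := n)
      exact_mod_cast this
    calc (4 : ℝ) ^ n * (n + 1) ≤ 4 ^ n * 2 ^ n := by gcongr
      _ = 8 ^ n := by rw [← mul_pow]; norm_num
  have h5 : (8 : ℝ) ^ n * 8 ≤ Real.exp (3 * (n + 1)) := by
    calc (8 : ℝ) ^ n * 8 = 8 ^ (n + 1) := by ring
      _ ≤ Real.exp 3 ^ (n + 1) := by gcongr
      _ = _ := by rw [← Real.exp_nat_mul]; congr 1; push_cast; ring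
  rw [le_div_iff₀ (by norm_num)]
  calc (4 : ℝ) ^ n * (n + 1) * (15 / 16) ^ s * 8
      ≤ 8 ^ n * Real.exp (-(3 * (n + 1) + y)) * 8 := by gcongr
    _ = (8 ^ n * 8) * Real.exp (-(3 * (n + 1) + y)) := by ring
    _ ≤ Real.exp (3 * (n + 1)) * Real.exp (-(3 * (n + 1) + y)) := by gcongr
    _ = _ := by rw [← Real.exp_add]; congr 1; ring

/-- The total of the contributions to the space of the algorithm. -/
lemma total_space_le {nn Λ c E r G lP lT lT' s L lN : ℝ} (hn : 1 ≤ nn) (hΛ : 1 ≤ Λ) (hc : 0 ≤ c)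
    (hE : 0 ≤ E) (hG0 : 0 ≤ G) (hL0 : 0 ≤ L) (hlN0 : 0 ≤ lN)
    (hr : r ≤ (13 + 2 * c) * Λ) (hG : G ≤ 3 * Λ)
    (hP : lP ≤ E * Λ) (hT' : lT' ≤ 2 * Λ) (hT : lT ≤ 2 * Λ) (hs : s ≤ (97 + 16 * c) * (nn * Λ)) (hL : L ≤ 3 * Λ)
    (hN : lN ≤ (8 + c) * Λ) :
    2 * (r + G * (lP + lT' + nn * lT + 3 * s * L * lN)) + 1 ≤
      (2 * ((13 + 2 * c) + 3 * (E + 4 + 9 * (97 + 16 * c) * (8 + c))) + 1) * nn * Λ ^ 4 := by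
  have hX : 1 ≤ nn * Λ ^ 4 := one_le_mul_of_one_le_of_one_le hn (one_le_pow₀ hΛ)
  have h1 : Λ ≤ nn * Λ ^ 4 := by
    calc Λ = 1 * Λ ^ 1 := by ring
      _ ≤ nn * Λ ^ 4 := by gcongr; norm_num
  have h2 : lP + lT' + nn * lT + 3 * s * L * lN ≤
      (E + 4 + 9 * (97 + 16 * c) * (8 + c)) * (nn * Λ ^ 3) := by
    have b0 : Λ ≤ nn * Λ ^ 3 := by
      calc Λ = 1 * Λ ^ 1 := by ring
        _ ≤ nn * Λ ^ 3 := by gcongr; norm_num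
    have b3 : nn * Λ ≤ nn * Λ ^ 3 := by
      calc nn * Λ = nn * Λ ^ 1 := by ring
        _ ≤ nn * Λ ^ 3 := by gcongr; norm_num
    have b1 : lP ≤ E * (nn * Λ ^ 3) := hP.trans (by gcongr)
    have b2 : lT' ≤ 2 * (nn * Λ ^ 3) := hT'.trans (by gcongr)
    have b4 : nn * lT ≤ 2 * (nn * Λ ^ 3) := by
      calc nn * lT ≤ nn * (2 * Λ) := by gcongr
        _ = 2 * (nn * Λ) := by ring
        _ ≤ _ := by gcongr
    have b5 : 3 * s * L * lN ≤ 9 * (97 + 16 * c) * (8 + c) * (nn * Λ ^ 3) := by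
      calc 3 * s * L * lN ≤ 3 * ((97 + 16 * c) * (nn * Λ)) * (3 * Λ) * ((8 + c) * Λ) := by
            gcongr
        _ = _ := by ring
    linarith
  -- The four factors Λ come from the number of guesses, s, L and log N.
  have h3 : G * (lP + lT' + nn * lT + 3 * s * L * lN) ≤
      3 * (E + 4 + 9 * (97 + 16 * c) * (8 + c)) * (nn * Λ ^ 4) := by
    calc G * (lP + lT' + nn * lT + 3 * s * L * lN)
        ≤ G * ((E + 4 + 9 * (97 + 16 * c) * (8 + c)) * (nn * Λ ^ 3)) := by gcongr
      _ ≤ 3 * Λ * ((E + 4 + 9 * (97 + 16 * c) * (8 + c)) * (nn * Λ ^ 3)) := by gcongr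
      _ = _ := by ring
  have h4 : r ≤ (13 + 2 * c) * (nn * Λ ^ 4) := hr.trans (by gcongr)
  linarith

end Parameters

/-- For k = 0 the empty answer is optimal; this case is separate because the thresholds divide by k.
-/
lemma exists_trivial_alg {n : ℕ} (ε δ B : ℝ) (hδ : 0 ≤ δ) (hB : 0 ≤ B) :
    ∃ A : StreamAlg n, A.passes = 0 ∧ (A.space : ℝ) ≤ B ∧ ∀ F : List (SetUpdate n),
      ENNReal.ofReal (1 - δ) ≤ A.prob F (IsApproxSolution F 0 ε) := by
  refine ⟨seededAlg 0 0 Unit () (fun _ x _ => x) (fun _ x => x) (fun _ => ∅), rfl, ?_, fun F => ?_⟩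
  · rw [StreamAlg.space, seededAlg_card_mem]
    simpa using hB
  · refine seededAlg_prob_ge F _ δ ∅ (by simpa using hδ) fun b _ => ?_
    refine ⟨by simp, by simp, ?_, ?_⟩
    · intro S hS
      simp [chosenSets] at hS
    · rw [opt_zero]
      simp [chosenSets, coverage]

lemma exists_coverage_alg {ε : ℝ} (hε : 0 < ε) (hε1 : ε < 1) (c : ℕ) {n m k : ℕ} (T : ℕ)
    (hn : 1 ≤ n) (hm : 2 ≤ m) (hk : 1 ≤ k) :
    ∃ A : StreamAlg n, (A.passes : ℝ) ≤ 90 * (Real.log m / ε) ∧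
      (A.space : ℝ) ≤ (2 * ((13 + 2 * c) + 3 * (90 / ε + 4 + 9 * (97 + 16 * c) * (8 + c))) + 1) *
        n * (1 + Real.log n + Real.log m + Real.log T) ^ 4 ∧
      ∀ F : List (SetUpdate n), IsDynamicStream F → F.length ≤ T → (present F).card ≤ m →
        ENNReal.ofReal (1 - 1 / ((n : ℝ) * (m : ℝ)) ^ c) ≤
          A.prob F (IsApproxSolution F k (Real.exp 1 / (Real.exp 1 - 1) + ε)) := by
  have hn' : (1 : ℝ) ≤ n := by exact_mod_cast hn
  have hm' : (2 : ℝ) ≤ m := by exact_mod_cast hm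
  have hln : 0 ≤ Real.log n := Real.log_natCast_nonneg n
  have hlm : 0 ≤ Real.log m := Real.log_natCast_nonneg m
  have hlT : 0 ≤ Real.log T := Real.log_natCast_nonneg T
  set Λ := 1 + Real.log n + Real.log m + Real.log T with hΛ
  have hΛ1 : 1 ≤ Λ := by linarith
  have hlog2 : Real.log 2 ≤ 1 := by have := Real.log_two_lt_d9; linarith
  have hT1 := log_add_one_le T
  have hT2 := log_add_two_le T
  set y : ℝ := c * (Real.log n + Real.log m) with hy
  have hy0 : 0 ≤ y := by positivity
  have hyΛ : y ≤ c * Λ := by rw [hy]; gcongr; linarith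
  have hpow : ((n : ℝ) * m) ^ c = Real.exp y := by
    rw [hy, ← Real.log_mul (by positivity) (by positivity), ← Real.log_pow,
      Real.exp_log (by positivity)]
  have hδ : 1 / ((n : ℝ) * (m : ℝ)) ^ c = Real.exp (-y) := by
    rw [hpow, Real.exp_neg, one_div]
  -- Bertrand's postulate: N is prime for the inverses, exceeds T to preserve multiplicities, is
  -- large enough that keys rarely collide, and still has O(Λ) bits for fixed c.
  obtain ⟨N, hNp, hN1, hN2⟩ := Nat.exists_prime_lt_and_le_two_mul
    (8 * (T + 1) ^ 2 * (n * m) ^ c) (by positivity)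
  have : Fact N.Prime := ⟨hNp⟩
  have hN1' : 8 * ((T : ℝ) + 1) ^ 2 * Real.exp y < N := by
    rw [← hpow]; exact_mod_cast hN1
  have hN2' : (N : ℝ) ≤ 2 * (8 * ((T : ℝ) + 1) ^ 2 * Real.exp y) := by
    rw [← hpow]; exact_mod_cast hN2
  have hN0 : (0 : ℝ) < N := by exact_mod_cast hNp.pos
  have hey : 1 ≤ Real.exp y := Real.one_le_exp hy0
  have hTN : T < N := by
    have h0 : (0 : ℝ) ≤ T := by positivity
    have h1 : (T : ℝ) + 1 ≤ 8 * ((T : ℝ) + 1) ^ 2 * Real.exp y := by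
      calc (T : ℝ) + 1 ≤ 8 * ((T : ℝ) + 1) ^ 2 * 1 := by nlinarith
        _ ≤ _ := by gcongr
    have : (T : ℝ) < N := by linarith
    exact_mod_cast this
  have hcoll : (T : ℝ) ^ 2 / N ≤ Real.exp (-y) / 8 := by
    rw [div_le_div_iff₀ hN0 (by norm_num)]
    have h1 : Real.exp (-y) * (8 * ((T : ℝ) + 1) ^ 2 * Real.exp y) ≤ Real.exp (-y) * N := by
      gcongr
    have h2 : Real.exp (-y) * (8 * ((T : ℝ) + 1) ^ 2 * Real.exp y) = 8 * ((T : ℝ) + 1) ^ 2 := by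
      have : Real.exp (-y) * Real.exp y = 1 := by rw [← Real.exp_add]; simp
      calc _ = 8 * ((T : ℝ) + 1) ^ 2 * (Real.exp (-y) * Real.exp y) := by ring
        _ = _ := by rw [this, mul_one]
    have h0 : (0 : ℝ) ≤ T := by positivity
    nlinarith
  set s := ⌈16 * (3 * ((n : ℝ) + 1) + y)⌉₊ with hs
  have hsge : 16 * (3 * ((n : ℝ) + 1) + y) ≤ s := Nat.le_ceil _
  have hslt : (s : ℝ) < 16 * (3 * ((n : ℝ) + 1) + y) + 1 := Nat.ceil_lt_add_one (by positivity)
  -- R is the number of seeds that the table needs for failure probability exp(-y).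
  set R := 4 * (n + 2) * (T + 1) * (n * m) ^ c with hR
  set r := Nat.clog 2 R with hr
  have hR1 : 1 ≤ R := Nat.one_le_iff_ne_zero.2 (by positivity)
  have hR' : (R : ℝ) = 4 * ((n : ℝ) + 2) * (T + 1) * Real.exp y := by
    rw [← hpow, hR]; push_cast; ring
  have hRr : 4 * ((n : ℝ) + 2) * (T + 1) ≤ Real.exp (-y) * 2 ^ r := by
    have h1 : (R : ℝ) ≤ 2 ^ r := by exact_mod_cast Nat.le_pow_clog (by norm_num) R
    rw [hR'] at h1
    calc 4 * ((n : ℝ) + 2) * (T + 1) =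
          Real.exp (-y) * (4 * ((n : ℝ) + 2) * (T + 1) * Real.exp y) := by
          rw [Real.exp_neg]; field_simp
      _ ≤ _ := by gcongr
  obtain ⟨f, hf⟩ := exists_good_seed_table (n := n) (L := Nat.log 2 m + 2) (m := m) rfl
    (union_bound_le hsge) hcoll hRr
  refine ⟨coverageAlg k T (3 * ((Nat.log 2 m + 1) * (⌈8 / ε⌉₊ + 1))) N s (Nat.log 2 m + 2)
    (Nat.clog 2 n) (Nat.log 2 m + 1) r (ε / 4) f, passes_le hε hε1 hm, ?_, ?_⟩
  · have hP := passes_le hε hε1 hm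
    refine (coverageAlg_space_le f).trans ?_
    set P := 3 * ((Nat.log 2 m + 1) * (⌈8 / ε⌉₊ + 1))
    -- The crude bound log(P+1) ≤ P suffices, since D may depend on ε.
    have hlP : Real.log ((P : ℝ) + 1) ≤ 90 / ε * Λ := by
      have h1 := Real.log_le_sub_one_of_pos (show (0 : ℝ) < (P : ℝ) + 1 by positivity)
      calc Real.log ((P : ℝ) + 1) ≤ P := by linarith
        _ ≤ 90 * (Real.log m / ε) := hP
        _ = 90 / ε * Real.log m := by ring
        _ ≤ _ := by gcongr; linarith
    have hG : (Nat.clog 2 n : ℝ) + 1 ≤ 3 * Λ := by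
      have := clog_le_log hn
      linarith
    have hL : ((Nat.log 2 m + 2 : ℕ) : ℝ) ≤ 3 * Λ := by
      have := log_le_log (show 1 ≤ m by omega)
      push_cast
      linarith
    have hsΛ : (s : ℝ) ≤ (97 + 16 * c) * (n * Λ) := by
      have h1 : (n : ℝ) ≤ n * Λ := le_mul_of_one_le_right (by linarith) hΛ1
      have h2 : (c : ℝ) * Λ ≤ c * (n * Λ) := by
        gcongr; exact le_mul_of_one_le_left (by linarith) hn'
      nlinarith
    have hlN : Real.log N ≤ (8 + c) * Λ := by
      have h1 := Real.log_le_log hN0 hN2'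
      have h2 : Real.log (2 * (8 * ((T : ℝ) + 1) ^ 2 * Real.exp y)) =
          4 * Real.log 2 + 2 * Real.log ((T : ℝ) + 1) + y := by
        rw [show 2 * (8 * ((T : ℝ) + 1) ^ 2 * Real.exp y) =
          2 ^ 4 * ((T : ℝ) + 1) ^ 2 * Real.exp y by ring,
          Real.log_mul (by positivity) (by positivity),
          Real.log_mul (by positivity) (by positivity), Real.log_pow, Real.log_pow, Real.log_exp]
        norm_num
      rw [h2] at h1
      linarith
    have hrΛ : (r : ℝ) ≤ (13 + 2 * c) * Λ := by
      have h1 := clog_le_log hR1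
      have h2 : Real.log (R : ℝ) =
          2 * Real.log 2 + Real.log ((n : ℝ) + 2) + Real.log ((T : ℝ) + 1) + y := by
        rw [hR', show (4 : ℝ) * ((n : ℝ) + 2) * (T + 1) * Real.exp y =
          2 ^ 2 * ((n : ℝ) + 2) * (T + 1) * Real.exp y by norm_num,
          Real.log_mul (by positivity) (by positivity),
          Real.log_mul (by positivity) (by positivity),
          Real.log_mul (by positivity) (by positivity), Real.log_pow, Real.log_exp]
        norm_num
      have h3 := log_add_two_le n
      rw [h2] at h1
      linarith
    have hNlog : 0 ≤ Real.log N := Real.log_natCast_nonneg N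
    have hE : 0 ≤ 90 / ε := by positivity
    have hG0 : 0 ≤ (Nat.clog 2 n : ℝ) + 1 := by positivity
    have hlT1 : Real.log ((T : ℝ) + 1) ≤ 2 * Λ := by linarith
    have hlT2 : Real.log ((T : ℝ) + 2) ≤ 2 * Λ := by linarith
    exact total_space_le hn' hΛ1 (Nat.cast_nonneg c) hE hG0
      (Nat.cast_nonneg (Nat.log 2 m + 2)) hNlog hrΛ hG hlP hlT1 hlT2 hsΛ hL hlN
  · intro F hF hFT hFm
    obtain ⟨bad, hb1, hb2⟩ := hf F hFT hFm
    rw [hδ]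
    exact coverageAlg_prob_ge hk hε hε1 hTN (Nat.succ_pos _)
      (Nat.lt_pow_succ_log_self (by norm_num) m) (two_mul_pow_ceil_le hε hε1) f hF hFT hFm hb1 hb2

end DynCoverage

theorem mainTheorem7 :
    ∃ (C : ℝ) (d : ℕ), 0 < C ∧
      ∀ ε : ℝ, 0 < ε → ε < 1 → ∀ c : ℕ, ∃ D : ℝ, 0 < D ∧
        ∀ n m k T : ℕ, 1 ≤ n → 2 ≤ m →
          ∃ A : DynCoverage.StreamAlg n,
            (A.passes : ℝ) ≤ C * (Real.log m / ε) ∧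
            (A.space : ℝ) ≤ D * n * (1 + Real.log n + Real.log m + Real.log T) ^ d ∧
            ∀ F : List (DynCoverage.SetUpdate n),
              DynCoverage.IsDynamicStream F → F.length ≤ T →
              (DynCoverage.present F).card ≤ m →
                ENNReal.ofReal (1 - 1 / ((n : ℝ) * (m : ℝ)) ^ c) ≤
                  A.prob F (DynCoverage.IsApproxSolution F k
                    (Real.exp 1 / (Real.exp 1 - 1) + ε)) := by
  refine ⟨90, 4, by norm_num, fun ε hε hε1 c => ⟨2 * ((13 + 2 * c) +
    3 * (90 / ε + 4 + 9 * (97 + 16 * c) * (8 + c))) + 1, by positivity,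
    fun n m k T hn hm => ?_⟩⟩
  rcases Nat.eq_zero_or_pos k with rfl | hk
  · have hln : 0 ≤ Real.log n := Real.log_natCast_nonneg n
    have hlm : 0 ≤ Real.log m := Real.log_natCast_nonneg m
    have hlT : 0 ≤ Real.log T := Real.log_natCast_nonneg T
    obtain ⟨A, h1, h2, h3⟩ := DynCoverage.exists_trivial_alg (n := n)
      (Real.exp 1 / (Real.exp 1 - 1) + ε) (1 / ((n : ℝ) * (m : ℝ)) ^ c)
      ((2 * ((13 + 2 * c) + 3 * (90 / ε + 4 + 9 * (97 + 16 * c) * (8 + c))) + 1) * n *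
        (1 + Real.log n + Real.log m + Real.log T) ^ 4) (by positivity) (by positivity)
    refine ⟨A, ?_, h2, fun F _ _ _ => h3 F⟩
    rw [h1, Nat.cast_zero]
    positivity
  · exact DynCoverage.exists_coverage_alg hε hε1 c T hn hm hk
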